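/- Let $0<\alpha<1$. The Darling--Mandelbrot law of parameter $\alpha$ is the unique probability measure on $\mathbb R$ with characteristic function $$\phi_\alpha(s)=\Bigl(1-\sum_{n\ge1}\frac{\alpha}{n-\alpha}\,\frac{(is)^n}{n!}\Bigr)^{-1}\qquad(s\in\mathbb R).$$ This law exists and has a density $g\ge 0$ which vanishes for $x\le 0$ and is continuous for $x>0$ (and is uniquely determined by this). The density is given for all $x$ by the locally finite sum $$g(x)=\sum_{k=0}^\infty g_k(x),$$ where $g_k$ is continuous for $x>0$, non-zero exactly for $x>k$, analytic on $(k,\infty)$, and has the following two equivalent definitions. (i) Let $C_0=\sin(\alpha\pi)/\pi$, let $a(x)=C_0x^{\alpha-1}$ for $x>0$ and $a(x)=0$ otherwise, and let $b(x)=-C_0\,(x-1)^\alpha/x$ for $x>1$ and $b(x)=0$ otherwise. Then $$g_k=a*\underbrace{b*\cdots*b}_{k\text{ times}},$$ where $(u*v)(x)=\int_{\mathbb R}u(t)v(x-t)\,dt$ and all the integrals converge absolutely. (ii) Let $\beta_k=\alpha+k(1+\alpha)$, $C_k=\dfrac1{\Gamma(1-\alpha)\,\Gamma(-\alpha)^k\,\Gamma(\beta_k)}$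 and $(y)_n=\Gamma(y+n)/\Gamma(y)$. Then $g_k$ is the function that vanishes for $x\le k$, is given for $k<x<k+1$ by $$g_k(x)=C_k(x-k)^{\beta_k-1}\sum_{n_1,\dots,n_k\ge0}\frac{(1+\alpha)_{n_1}\cdots(1+\alpha)_{n_k}}{(\beta_k)_{n_1+\cdots+n_k}}\,(k-x)^{n_1+\cdots+n_k},$$ the series being convergent, and for $x\ge k+1$ by analytic continuation along $(k,\infty)$. -/

import Mathlib

open MeasureTheory Set

noncomputable section

namespace DarlingMandelbrot

/-- The characteristic function
`φ_α(s) = (1 - ∑_{n ≥ 1} α / (n - α) * (i s)^n / n!)⁻¹`; the sum is re-indexed by `n = m + 1`. -/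
def phi (α s : ℝ) : ℂ :=
  (1 - ∑' m : ℕ, (α : ℂ) / (((m + 1 : ℕ) : ℂ) - (α : ℂ)) *
    ((Complex.I * (s : ℂ)) ^ (m + 1) / ((m + 1).factorial : ℂ)))⁻¹

/-- The Darling–Mandelbrot law of parameter `α`: the probability measure on `ℝ` whose
characteristic function is `φ_α`. -/
def IsLaw (α : ℝ) (μ : Measure ℝ) : Prop :=
  IsProbabilityMeasure μ ∧ ∀ s : ℝ, charFun μ s = phi α s

/-- `g` is the density of `μ` with respect to Lebesgue measure, in its version that vanishes for
`x ≤ 0` and is continuous for `x > 0`. -/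
def IsContDensity (μ : Measure ℝ) (g : ℝ → ℝ) : Prop :=
  (∀ x, 0 ≤ g x) ∧ (∀ x ≤ 0, g x = 0) ∧ ContinuousOn g (Ioi 0) ∧
    μ = volume.withDensity (fun x => ENNReal.ofReal (g x))

/-- `C_0 = sin(α π) / π`. -/
def C0 (α : ℝ) : ℝ := Real.sin (α * Real.pi) / Real.pi

/-- `a(x) = C_0 x^(α-1)` for `x > 0`, and `0` otherwise. -/
def a (α : ℝ) : ℝ → ℝ :=
  (Ioi (0 : ℝ)).indicator fun x => C0 α * x ^ (α - 1)

/-- `b(x) = -C_0 (x-1)^α / x` for `x > 1`, and `0` otherwise. -/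
def b (α : ℝ) : ℝ → ℝ :=
  (Ioi (1 : ℝ)).indicator fun x => -C0 α * ((x - 1) ^ α / x)

/-- The convolution product `a * b * ⋯ * b` with `k` factors `b`, bracketed from the left:
each step is `(u * v)(x) = ∫ u(t) v(x - t) dt`. -/
def gConv (α : ℝ) : ℕ → ℝ → ℝ
  | 0 => a α
  | k + 1 => convolution (gConv α k) (b α) (ContinuousLinearMap.mul ℝ ℝ) volume

/-- The rising factorial `(y)_n = Γ(y + n) / Γ(y)`. -/
def rising (y : ℝ) (n : ℕ) : ℝ := Real.Gamma (y + n) / Real.Gamma y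

/-- `β_k = α + k (1 + α)`. -/
def beta (α : ℝ) (k : ℕ) : ℝ := α + k * (1 + α)

/-- `C_k = 1 / (Γ(1-α) Γ(-α)^k Γ(β_k))`. -/
def C (α : ℝ) (k : ℕ) : ℝ :=
  1 / (Real.Gamma (1 - α) * Real.Gamma (-α) ^ k * Real.Gamma (beta α k))

/-- The term of index `(n_1, …, n_k)` of the multiple power series at the point `x`. -/
def seriesTerm (α : ℝ) (k : ℕ) (x : ℝ) (n : Fin k → ℕ) : ℝ :=
  (∏ i, rising (1 + α) (n i)) / rising (beta α k) (∑ i, n i) * ((k : ℝ) - x) ^ (∑ i, n i)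

/-- `f` vanishes for `x ≤ k`, is given by the convergent multiple power series for
`k < x < k + 1`, and by its analytic continuation along `(k, ∞)` for `x ≥ k + 1`. -/
def IsSeriesFunction (α : ℝ) (k : ℕ) (f : ℝ → ℝ) : Prop :=
  (∀ x ≤ (k : ℝ), f x = 0) ∧
  (∀ x ∈ Ioo (k : ℝ) (k + 1), Summable (seriesTerm α k x) ∧
    f x = C α k * (x - k) ^ (beta α k - 1) * ∑' n : Fin k → ℕ, seriesTerm α k x n) ∧
  AnalyticOnNhd ℝ f (Ioi (k : ℝ))

end DarlingMandelbrot

end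

noncomputable section
namespace DarlingMandelbrot

open scoped ENNReal

/-! The law is that of the `α`-stable subordinator with Lévy density `α x^(-α-1)`, taken just before
its first jump of size at least `1`. Such jumps have rate `1`, so this is the subordinator with
jumps in `(0, 1)` at an independent exponential time. The function `a` is the potential density of
the stable process. The proof keeps only the analytic identities behind this picture: `a * jump =
-b` (`lconvolution_aE_jump`), the splitting of the first passage above `1` by jump size
(`lconvolution_aTrunc_jump_add`), and the Markov property at that passage
(`lconvolution_passage_aE_add`).

The density is built as the renewal series `∑ aTrunc * smallPassage^(*n)`, whose terms are
nonnegative, so convergence and signs cause no trouble. The three identities telescope to `g = a + g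
* b` (`density_eq`). As `b` lives on `(1, ∞)`, iterating this on each bounded interval gives the
finite sum of the `g_k`. On the Fourier side the renewal series is geometric, and
`laplaceExp_mul_expInt_add_passageLaplace` identifies its sum with `phi`.

For the two descriptions of `g_k`, rescaling the convolution to `(0, 1)` gives `g_k(k + y) = y^(β_k
- 1) r_k(y)`, where `r_k` obeys a one-dimensional integral recursion. The recursion shows that `r_k`
is holomorphic for `Re z > -1` and has sign `(-1)^k`. Expanding its kernel `1 / (1 + y (1 - t))`
geometrically turns it into Beta integrals and yields the multiple series (`hasSum_regPart`). The
identity theorem does the rest. -/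

/-! ### Holomorphy of the integral recursion on a half-plane -/

/-- The half-plane `Re z > -1`. -/
def halfPlane : Set ℂ := {z | -1 < z.re}

lemma isOpen_halfPlane : IsOpen halfPlane :=
  isOpen_lt continuous_const Complex.continuous_re

lemma mul_mem_halfPlane {z : ℂ} (hz : z ∈ halfPlane) {t : ℝ} (ht : t ∈ Icc (0 : ℝ) 1) :
    z * (t : ℂ) ∈ halfPlane := by
  have h : -1 < z.re := hz
  simp only [halfPlane, mem_ofPred_eq, Complex.re_mul_ofReal]
  rcases eq_or_lt_of_le ht.1 with h0 | h0
  · rw [← h0]; norm_num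
  · nlinarith [ht.2]

lemma one_add_mul_ne_zero {z : ℂ} (hz : z ∈ halfPlane) {t : ℝ} (ht : t ∈ Icc (0 : ℝ) 1) :
    1 + z * (1 - (t : ℂ)) ≠ 0 := by
  intro h
  have h1 := mul_mem_halfPlane hz (t := 1 - t) ⟨by linarith [ht.2], by linarith [ht.1]⟩
  simp only [halfPlane, mem_ofPred_eq] at h1
  have := congrArg Complex.re h
  push_cast at h1
  simp only [Complex.add_re, Complex.one_re, Complex.zero_re] at this
  linarith

lemma integrableOn_Ioo_mul_continuousOn {w : ℝ → ℝ} (hw : IntegrableOn w (Ioo 0 1)) {f : ℝ → ℂ}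
    (hf : ContinuousOn f (Icc 0 1)) : IntegrableOn (fun t => (w t : ℂ) * f t) (Ioo 0 1) := by
  rw [← integrableOn_Icc_iff_integrableOn_Ioo] at hw ⊢
  exact IntegrableOn.mul_continuousOn (hw.ofReal) hf isCompact_Icc

/-- Induction step for the holomorphy of `regPartC`, by differentiation under the integral sign. The
`z`-derivative `E` of the kernel is continuous on the compact set `closedBall × [0, 1]`, hence
bounded there by some `M`, and `‖w‖ * M` dominates. -/
lemma differentiableOn_integral_kernel {w : ℝ → ℝ} (hw : IntegrableOn w (Ioo 0 1)) {H : ℂ → ℂ}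
    (hH : DifferentiableOn ℂ H halfPlane) :
    DifferentiableOn ℂ (fun z : ℂ => ∫ t in Ioo (0 : ℝ) 1,
      (w t : ℂ) * (H (z * t) / (1 + z * (1 - t)))) halfPlane := by
  intro z₀ hz₀
  obtain ⟨r, hr, hball⟩ := Metric.nhds_basis_closedBall.mem_iff.1 (isOpen_halfPlane.mem_nhds hz₀)
  have hH' : ContinuousOn (deriv H) halfPlane :=
    (hH.deriv isOpen_halfPlane).continuousOn
  set E : ℂ × ℝ → ℂ := fun p =>
    (deriv H (p.1 * p.2) * p.2 * (1 + p.1 * (1 - p.2)) - H (p.1 * p.2) * (1 - p.2)) /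
      (1 + p.1 * (1 - p.2)) ^ 2 with hE
  have hcomp : ∀ {f : ℂ → ℂ}, ContinuousOn f halfPlane →
      ContinuousOn (fun p : ℂ × ℝ => f (p.1 * p.2)) (halfPlane ×ˢ Icc (0 : ℝ) 1) :=
    fun hf => hf.comp (by fun_prop) fun p hp => mul_mem_halfPlane hp.1 hp.2
  have hne : ∀ p ∈ halfPlane ×ˢ Icc (0 : ℝ) 1, 1 + p.1 * (1 - (p.2 : ℂ)) ≠ 0 :=
    fun p hp => one_add_mul_ne_zero hp.1 hp.2
  have hEc : ContinuousOn E (halfPlane ×ˢ Icc (0 : ℝ) 1) := by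
    have h1 := hcomp hH'
    have h2 := hcomp hH.continuousOn
    have h3 : Continuous fun p : ℂ × ℝ => (p.2 : ℂ) := by fun_prop
    refine ContinuousOn.div ?_ (by fun_prop) fun p hp => pow_ne_zero 2 (hne p hp)
    exact ((h1.mul h3.continuousOn).mul (by fun_prop)).sub (h2.mul (by fun_prop))
  have hFc : ContinuousOn (fun p : ℂ × ℝ => H (p.1 * p.2) / (1 + p.1 * (1 - p.2)))
      (halfPlane ×ˢ Icc (0 : ℝ) 1) :=
    (hcomp hH.continuousOn).div (by fun_prop) hne
  have hslice : ∀ {f : ℂ × ℝ → ℂ}, ContinuousOn f (halfPlane ×ˢ Icc (0 : ℝ) 1) →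
      ∀ z ∈ halfPlane, IntegrableOn (fun t => (w t : ℂ) * f (z, t)) (Ioo 0 1) :=
    fun hf z hz => integrableOn_Ioo_mul_continuousOn hw
      (hf.comp (by fun_prop) fun t ht => ⟨hz, ht⟩)
  obtain ⟨M, hM⟩ := ((isCompact_closedBall z₀ r).prod isCompact_Icc).exists_bound_of_continuousOn
    (hEc.mono (prod_mono hball le_rfl))
  have key := hasDerivAt_integral_of_dominated_loc_of_deriv_le
    (μ := volume.restrict (Ioo (0 : ℝ) 1)) (s := Metric.closedBall z₀ r) (x₀ := z₀)
    (F := fun z t => (w t : ℂ) * (H (z * t) / (1 + z * (1 - t))))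
    (F' := fun z t => (w t : ℂ) * E (z, t)) (bound := fun t => ‖w t‖ * M)
    (Metric.closedBall_mem_nhds _ hr) ?_ (hslice hFc z₀ hz₀) (hslice hEc z₀ hz₀).1 ?_
    (hw.norm.mul_const M) ?_
  · exact key.2.differentiableAt.differentiableWithinAt
  · filter_upwards [isOpen_halfPlane.mem_nhds hz₀] with z hz
    exact (hslice hFc z hz).1
  · refine (ae_restrict_iff' measurableSet_Ioo).2 (.of_forall fun t ht z hz => ?_)
    rw [norm_mul, Complex.norm_real]
    gcongr
    exact hM (z, t) ⟨hz, Ioo_subset_Icc_self ht⟩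
  · refine (ae_restrict_iff' measurableSet_Ioo).2 (.of_forall fun t ht z hz => ?_)
    have ht' := Ioo_subset_Icc_self ht
    have hzt := mul_mem_halfPlane (hball hz) ht'
    have h1 : HasDerivAt (fun z : ℂ => H (z * t)) (deriv H (z * t) * t) z := by
      have := (hH.differentiableAt (isOpen_halfPlane.mem_nhds hzt)).hasDerivAt
      exact HasDerivAt.comp z this (by simpa using (hasDerivAt_id z).mul_const (t : ℂ))
    have h2 : HasDerivAt (fun z : ℂ => 1 + z * (1 - (t : ℂ))) (1 - (t : ℂ)) z := by
      simpa using ((hasDerivAt_id z).mul_const (1 - (t : ℂ))).const_add 1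
    exact (h1.div h2 (one_add_mul_ne_zero (hball hz) ht')).const_mul _

/-! ### The real Beta integral -/

section BetaIntegral

lemma ofReal_beta_kernel {u v t : ℝ} (ht : t ∈ Ioo (0 : ℝ) 1) :
    ((t ^ (u - 1) * (1 - t) ^ (v - 1) : ℝ) : ℂ) =
      (t : ℂ) ^ ((u : ℂ) - 1) * (1 - (t : ℂ)) ^ ((v : ℂ) - 1) := by
  push_cast [Complex.ofReal_cpow ht.1.le, Complex.ofReal_cpow (sub_nonneg.2 ht.2.le)]
  rfl

lemma integrableOn_beta_kernel {u v : ℝ} (hu : 0 < u) (hv : 0 < v) :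
    IntegrableOn (fun t : ℝ => t ^ (u - 1) * (1 - t) ^ (v - 1)) (Ioo 0 1) := by
  have h := Complex.betaIntegral_convergent (u := u) (v := v) (by simpa) (by simpa)
  rw [intervalIntegrable_iff_integrableOn_Ioo_of_le zero_le_one] at h
  have h2 := (h.congr_fun (fun t ht => (ofReal_beta_kernel ht).symm) measurableSet_Ioo).re
  simpa [IntegrableOn] using h2

lemma integral_beta_kernel {u v : ℝ} (hu : 0 < u) (hv : 0 < v) :
    ∫ t in Ioo (0 : ℝ) 1, t ^ (u - 1) * (1 - t) ^ (v - 1) =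
      Real.Gamma u * Real.Gamma v / Real.Gamma (u + v) := by
  have h := Complex.betaIntegral_eq_Gamma_mul_div u v (by simpa) (by simpa)
  rw [Complex.betaIntegral, intervalIntegral.integral_of_le zero_le_one,
    integral_Ioc_eq_integral_Ioo] at h
  rw [← Complex.ofReal_inj, ← integral_complex_ofReal,
    setIntegral_congr_fun measurableSet_Ioo (fun t ht => ofReal_beta_kernel ht), h]
  push_cast [← Complex.Gamma_ofReal]
  rfl

end BetaIntegral

/-! ### Factorisation of the convolutions into a power and an analytic part -/

/-- The weight `t^(β_k - 1) (1 - t)^α` on `(0, 1)`. -/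
def weight (α : ℝ) (k : ℕ) (t : ℝ) : ℝ := t ^ (beta α k - 1) * (1 - t) ^ α

/-- The regular part of `gConv`: `gConv α k (k + y) = y^(β_k - 1) * regPart α k y` for `y > 0`. -/
def regPart (α : ℝ) : ℕ → ℝ → ℝ
  | 0 => fun _ => C0 α
  | k + 1 => fun y => -C0 α * ∫ t in Ioo (0 : ℝ) 1,
      weight α k t * (regPart α k (y * t) / (1 + y * (1 - t)))

/-- The holomorphic extension of `regPart` to the half-plane `Re z > -1`. -/
def regPartC (α : ℝ) : ℕ → ℂ → ℂ
  | 0 => fun _ => C0 α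
  | k + 1 => fun z => -C0 α * ∫ t in Ioo (0 : ℝ) 1,
      (weight α k t : ℂ) * (regPartC α k (z * t) / (1 + z * (1 - t)))

lemma regPartC_ofReal (α : ℝ) (k : ℕ) (y : ℝ) : regPartC α k y = regPart α k y := by
  induction k generalizing y with
  | zero => rfl
  | succ k ih =>
    simp only [regPartC, regPart, Complex.ofReal_mul, Complex.ofReal_neg]
    rw [← integral_complex_ofReal]
    congr 2 with t
    rw [← Complex.ofReal_mul, ih]
    push_cast
    rfl

lemma regPart_eq_re (α : ℝ) (k : ℕ) (y : ℝ) : regPart α k y = (regPartC α k y).re := by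
  rw [regPartC_ofReal, Complex.ofReal_re]

lemma C0_pos {α : ℝ} (hα0 : 0 < α) (hα1 : α < 1) : 0 < C0 α :=
  div_pos (Real.sin_pos_of_pos_of_lt_pi (by positivity) (by nlinarith [Real.pi_pos])) Real.pi_pos

lemma beta_pos {α : ℝ} (hα0 : 0 < α) (k : ℕ) : 0 < beta α k := by
  unfold beta; positivity

lemma beta_succ (α : ℝ) (k : ℕ) : beta α (k + 1) = beta α k + (1 + α) := by
  unfold beta; push_cast; ring

lemma integrableOn_weight {α : ℝ} (hα0 : 0 < α) (k : ℕ) :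
    IntegrableOn (weight α k) (Ioo 0 1) := by
  have := integrableOn_beta_kernel (beta_pos hα0 k) (v := 1 + α) (by linarith)
  simpa only [add_sub_cancel_left] using! this

lemma weight_pos (α : ℝ) (k : ℕ) {t : ℝ} (ht : t ∈ Ioo (0 : ℝ) 1) : 0 < weight α k t :=
  mul_pos (Real.rpow_pos_of_pos ht.1 _) (Real.rpow_pos_of_pos (sub_pos.2 ht.2) _)

lemma differentiableOn_regPartC {α : ℝ} (hα0 : 0 < α) (k : ℕ) :
    DifferentiableOn ℂ (regPartC α k) halfPlane := by
  induction k with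
  | zero => exact differentiableOn_const _
  | succ k ih =>
    exact (differentiableOn_integral_kernel (integrableOn_weight hα0 k) ih).const_mul _

lemma analyticAt_regPart {α : ℝ} (hα0 : 0 < α) (k : ℕ) {y : ℝ} (hy : -1 < y) :
    AnalyticAt ℝ (regPart α k) y := by
  have h1 : AnalyticAt ℂ (regPartC α k) (y : ℂ) :=
    (differentiableOn_regPartC hα0 k).analyticAt (isOpen_halfPlane.mem_nhds (by simpa [halfPlane]))
  have h2 := h1.re_ofReal
  convert h2 using 2 with x
  exact regPart_eq_re α k x

lemma continuousOn_regPart {α : ℝ} (hα0 : 0 < α) (k : ℕ) :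
    ContinuousOn (regPart α k) (Ioi (-1)) :=
  fun _ hy => (analyticAt_regPart hα0 k hy).continuousAt.continuousWithinAt

lemma integrableOn_regPart_kernel {α : ℝ} (hα0 : 0 < α) (k : ℕ) {y : ℝ} (hy : 0 ≤ y) :
    IntegrableOn (fun t => weight α k t * (regPart α k (y * t) / (1 + y * (1 - t))))
      (Ioo 0 1) := by
  have hw := integrableOn_weight hα0 k
  rw [← integrableOn_Icc_iff_integrableOn_Ioo] at hw ⊢
  refine hw.mul_continuousOn ?_ isCompact_Icc
  refine ContinuousOn.div ?_ (by fun_prop) fun t ht => ?_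
  · refine (continuousOn_regPart hα0 k).comp (by fun_prop) fun t ht => ?_
    have := mul_nonneg hy ht.1
    simp only [mem_Ioi]; linarith
  · have := mul_nonneg hy (sub_nonneg.2 ht.2)
    positivity

/-- Every factor in the recursion is positive except `-C0 α`, so each step flips the sign. The
resulting nonvanishing is what makes the support of `gConv` exact. -/
lemma neg_one_pow_mul_regPart_pos {α : ℝ} (hα0 : 0 < α) (hα1 : α < 1) (k : ℕ) {y : ℝ}
    (hy : 0 ≤ y) : 0 < (-1) ^ k * regPart α k y := by
  induction k generalizing y with
  | zero => simpa [regPart] using C0_pos hα0 hα1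
  | succ k ih =>
    have hpos : ∀ t ∈ Ioo (0 : ℝ) 1,
        0 < (-1) ^ k * (weight α k t * (regPart α k (y * t) / (1 + y * (1 - t)))) := by
      intro t ht
      have h1 := ih (mul_nonneg hy ht.1.le)
      have h2 := weight_pos α k ht
      have h3 := mul_nonneg hy (sub_nonneg.2 ht.2.le)
      rw [show (-1) ^ k * (weight α k t * (regPart α k (y * t) / (1 + y * (1 - t)))) =
        weight α k t * (((-1) ^ k * regPart α k (y * t)) / (1 + y * (1 - t))) by ring]
      positivity
    have hint : 0 < ∫ t in Ioo (0 : ℝ) 1,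
        (-1) ^ k * (weight α k t * (regPart α k (y * t) / (1 + y * (1 - t)))) := by
      rw [setIntegral_pos_iff_support_of_nonneg_ae]
      · rw [inter_eq_self_of_subset_right fun t ht => Function.mem_support.2 (hpos t ht).ne']
        simp
      · exact (ae_restrict_iff' measurableSet_Ioo).2 (.of_forall fun t ht => (hpos t ht).le)
      · exact (integrableOn_regPart_kernel hα0 k hy).const_mul _
    rw [integral_const_mul] at hint
    have := mul_pos (C0_pos hα0 hα1) hint
    simp only [regPart]
    convert! this using 1
    ring

lemma a_of_pos (α : ℝ) {x : ℝ} (hx : 0 < x) : a α x = C0 α * x ^ (α - 1) :=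
  indicator_of_mem (mem_Ioi.2 hx) _

lemma a_of_nonpos (α : ℝ) {x : ℝ} (hx : x ≤ 0) : a α x = 0 :=
  indicator_of_notMem (by simpa using hx) _

lemma b_of_one_lt (α : ℝ) {x : ℝ} (hx : 1 < x) : b α x = -C0 α * ((x - 1) ^ α / x) :=
  indicator_of_mem (mem_Ioi.2 hx) _

lemma b_of_le_one (α : ℝ) {x : ℝ} (hx : x ≤ 1) : b α x = 0 :=
  indicator_of_notMem (by simpa using hx) _

lemma gConv_succ_apply (α : ℝ) (k : ℕ) (x : ℝ) :
    gConv α (k + 1) x = ∫ t, gConv α k t * b α (x - t) := rfl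

lemma gConv_of_le (α : ℝ) (k : ℕ) {x : ℝ} (hx : x ≤ k) : gConv α k x = 0 := by
  induction k generalizing x with
  | zero => exact a_of_nonpos α (by simpa using hx)
  | succ k ih =>
    rw [gConv_succ_apply]
    refine integral_eq_zero_of_ae (.of_forall fun t => ?_)
    push_cast at hx
    rcases le_or_gt t k with h | h
    · simp [ih h]
    · simp [b_of_le_one α (show x - t ≤ 1 by linarith)]

/-- At `x = k + 1 + y` the supports of the two factors confine the integration variable to `(k, k +
y)`. Writing it as `k + y * t` with `t ∈ (0, 1)` extracts the power of `y` and leaves an integral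
that is regular at `y = 0`. -/
lemma convolution_integrand_rescaled {α : ℝ} {k : ℕ} {y : ℝ} (hy : 0 < y)
    (hk : ∀ s : ℝ, 0 < s → gConv α k (k + s) = s ^ (beta α k - 1) * regPart α k s) (t : ℝ) :
    gConv α k (k + y * t) * b α ((k + 1 + y) - (k + y * t)) =
      (-C0 α * y ^ (beta α k - 1 + α)) * (Ioo (0 : ℝ) 1).indicator
        (fun t => weight α k t * (regPart α k (y * t) / (1 + y * (1 - t)))) t := by
  by_cases ht : t ∈ Ioo (0 : ℝ) 1
  · have h1 : 0 < y * t := mul_pos hy ht.1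
    have h2 : 0 < y * (1 - t) := mul_pos hy (sub_pos.2 ht.2)
    rw [indicator_of_mem ht, hk _ h1, b_of_one_lt α (by nlinarith),
      show (k + 1 + y : ℝ) - (k + y * t) - 1 = y * (1 - t) by ring,
      show (k + 1 + y : ℝ) - (k + y * t) = 1 + y * (1 - t) by ring,
      Real.mul_rpow hy.le ht.1.le, Real.mul_rpow hy.le (sub_pos.2 ht.2).le,
      Real.rpow_add hy, weight]
    ring
  · rw [indicator_of_notMem ht, mul_zero]
    rcases le_or_gt t 0 with h | h
    · rw [gConv_of_le α k (by nlinarith), zero_mul]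
    · have h1 : 1 ≤ t := not_lt.1 fun h' => ht ⟨h, h'⟩
      rw [b_of_le_one α (by nlinarith), mul_zero]

lemma gConv_add {α : ℝ} (k : ℕ) {y : ℝ} (hy : 0 < y) :
    gConv α k (k + y) = y ^ (beta α k - 1) * regPart α k y := by
  induction k generalizing y with
  | zero => simp [gConv, a_of_pos α hy, regPart, beta, mul_comm]
  | succ k ih =>
    have h := Measure.integral_comp_mul_left
      (fun t => gConv α k (k + t) * b α ((k + 1 + y) - (k + t))) y
    rw [integral_add_left_eq_self (fun t => gConv α k t * b α ((k + 1 + y) - t)) (k : ℝ)] at h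
    simp only [convolution_integrand_rescaled hy (fun s hs => ih hs)] at h
    rw [integral_const_mul, integral_indicator measurableSet_Ioo, abs_of_pos (inv_pos.2 hy),
      smul_eq_mul] at h
    push_cast
    rw [gConv_succ_apply, regPart, beta_succ,
      -- The last unit in the exponent is the Jacobian `y` of the rescaling.
      show beta α k + (1 + α) - 1 = (beta α k - 1 + α) + 1 by ring, Real.rpow_add_one hy.ne']
    rw [eq_inv_mul_iff_mul_eq₀ hy.ne'] at h
    rw [← h]
    ring

lemma convolutionExists_gConv_b {α : ℝ} (hα0 : 0 < α) (k : ℕ) :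
    ConvolutionExists (gConv α k) (b α) (ContinuousLinearMap.mul ℝ ℝ) volume := by
  intro x
  change Integrable (fun t => gConv α k t * b α (x - t))
  rcases le_or_gt x (k + 1) with hx | hx
  · convert! integrable_zero ℝ ℝ volume using 2 with t
    rcases le_or_gt t k with h | h
    · simp [gConv_of_le α k h]
    · simp [b_of_le_one α (show x - t ≤ 1 by linarith)]
  · obtain ⟨y, hy, rfl⟩ : ∃ y, 0 < y ∧ x = k + 1 + y := ⟨x - (k + 1), by linarith, by ring⟩
    have h : Integrable (fun s => gConv α k (k + s) * b α ((k + 1 + y) - (k + s))) := by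
      rw [← integrable_comp_mul_left_iff _ hy.ne']
      simp only [convolution_integrand_rescaled hy (fun s hs => gConv_add k hs)]
      exact ((integrable_indicator_iff measurableSet_Ioo).2
        (integrableOn_regPart_kernel hα0 k hy.le)).const_mul _
    simpa using h.comp_sub_right (k : ℝ)

lemma gConv_of_lt {α : ℝ} (k : ℕ) {x : ℝ} (hx : (k : ℝ) < x) :
    gConv α k x = (x - k) ^ (beta α k - 1) * regPart α k (x - k) := by
  rw [← gConv_add k (sub_pos.2 hx), add_sub_cancel]

lemma support_gConv {α : ℝ} (hα0 : 0 < α) (hα1 : α < 1) (k : ℕ) :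
    Function.support (gConv α k) = Ioi (k : ℝ) := by
  ext x
  rw [Function.mem_support, mem_Ioi]
  refine ⟨fun h => lt_of_not_ge fun h' => h (gConv_of_le α k h'), fun h => ?_⟩
  have h0 : 0 < x - k := sub_pos.2 h
  rw [gConv_of_lt k h]
  have := neg_one_pow_mul_regPart_pos hα0 hα1 k h0.le
  exact mul_ne_zero (Real.rpow_pos_of_pos h0 _).ne' (right_ne_zero_of_mul this.ne')

lemma analyticOnNhd_gConv {α : ℝ} (hα0 : 0 < α) (k : ℕ) :
    AnalyticOnNhd ℝ (gConv α k) (Ioi (k : ℝ)) := by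
  intro x hx
  have h0 : 0 < x - k := sub_pos.2 hx
  have hsub : AnalyticAt ℝ (fun x : ℝ => x - k) x := analyticAt_id.sub analyticAt_const
  have h1 : AnalyticAt ℝ (fun x : ℝ => (x - k) ^ (beta α k - 1)) x :=
    (((hsub.log h0).mul (analyticAt_const (v := beta α k - 1))).rexp).congr (by
      filter_upwards [isOpen_Ioi.mem_nhds hx] with z hz
      exact (Real.rpow_def_of_pos (sub_pos.2 hz) _).symm)
  have h2 : AnalyticAt ℝ (fun x : ℝ => regPart α k (x - k)) x :=
    (analyticAt_regPart hα0 k (by linarith)).fun_comp hsub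
  refine (h1.mul h2).congr ?_
  filter_upwards [isOpen_Ioi.mem_nhds hx] with z hz
  exact (gConv_of_lt k hz).symm

/-- Only `g_0` blows up at its left endpoint, and that endpoint `0` is excluded. For later indices
`β_k > 1`, so the power vanishes at `x = k`, and `max (x - k) 0` gives one continuous formula for
both sides. -/
lemma continuousOn_gConv {α : ℝ} (hα0 : 0 < α) (k : ℕ) :
    ContinuousOn (gConv α k) (Ioi 0) := by
  cases k with
  | zero => simpa using (analyticOnNhd_gConv hα0 0).continuousOn
  | succ k =>
    have hexp : 0 < beta α (k + 1) - 1 := by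
      rw [beta_succ]; linarith [beta_pos hα0 k]
    have heq : gConv α (k + 1) = fun x : ℝ => (max (x - (k + 1 : ℕ)) 0) ^ (beta α (k + 1) - 1) *
        regPart α (k + 1) (max (x - (k + 1 : ℕ)) 0) := by
      ext x
      rcases le_or_gt x (k + 1 : ℕ) with h | h
      · rw [gConv_of_le α _ h, max_eq_right (by linarith), Real.zero_rpow hexp.ne', zero_mul]
      · rw [gConv_of_lt _ h, max_eq_left (by linarith)]
    rw [heq]
    refine Continuous.continuousOn (Continuous.mul ?_ ?_)
    · exact (Continuous.rpow_const (by fun_prop) fun x => .inr hexp.le)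
    · exact (continuousOn_regPart hα0 (k + 1)).comp_continuous (by fun_prop) fun x => by
        have := le_max_right (x - (k + 1 : ℕ)) 0
        simp only [mem_Ioi]; linarith

/-- The supports `(k, ∞)` form a locally finite family. -/
lemma locallyFinite_support_gConv {α : ℝ} (hα0 : 0 < α) (hα1 : α < 1) :
    LocallyFinite (fun k : ℕ => Function.support (gConv α k)) := by
  intro x
  obtain ⟨n, hn⟩ := exists_nat_gt x
  refine ⟨Iio (n : ℝ), isOpen_Iio.mem_nhds hn, (finite_lt_nat n).subset ?_⟩
  rintro k ⟨z, hz, hz'⟩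
  simp only [support_gConv hα0 hα1] at hz
  have : (k : ℝ) < n := lt_trans hz hz'
  exact_mod_cast this

/-! ### The multiple power series -/

/-- The coefficient of `(k - x)^(n_1 + ⋯ + n_k)` in `seriesTerm`. -/
def coeff (α : ℝ) (k : ℕ) (n : Fin k → ℕ) : ℝ :=
  (∏ i, rising (1 + α) (n i)) / rising (beta α k) (∑ i, n i)

lemma seriesTerm_eq (α : ℝ) (k : ℕ) (x : ℝ) (n : Fin k → ℕ) :
    seriesTerm α k x n = coeff α k n * (k - x) ^ (∑ i, n i) := rfl

lemma rising_pos {y : ℝ} (hy : 0 < y) (n : ℕ) : 0 < rising y n :=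
  div_pos (Real.Gamma_pos_of_pos (by positivity)) (Real.Gamma_pos_of_pos hy)

lemma rising_zero {y : ℝ} (hy : 0 < y) : rising y 0 = 1 := by
  simp [rising, (Real.Gamma_pos_of_pos hy).ne']

lemma coeff_pos {α : ℝ} (hα0 : 0 < α) (k : ℕ) (n : Fin k → ℕ) : 0 < coeff α k n :=
  div_pos (Finset.prod_pos fun i _ => rising_pos (by linarith) _) (rising_pos (beta_pos hα0 k) _)

/-- The Beta integral that links the coefficients of consecutive orders. -/
lemma integral_weight_mul_pow {α : ℝ} (hα0 : 0 < α) (k N m : ℕ) :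
    ∫ t in Ioo (0 : ℝ) 1, weight α k t * (t ^ N * (1 - t) ^ m) =
      Real.Gamma (beta α k + N) * Real.Gamma (1 + α + m) /
        Real.Gamma (beta α (k + 1) + (m + N : ℕ)) := by
  have hb := beta_pos hα0 k
  have h := integral_beta_kernel (u := beta α k + N) (v := 1 + α + m) (by positivity)
    (by positivity)
  rw [show beta α k + N + (1 + α + m) = beta α (k + 1) + (m + N : ℕ) by
    rw [beta_succ]; push_cast; ring] at h
  rw [← h]
  refine setIntegral_congr_fun measurableSet_Ioo fun t ht => ?_
  have h1 : 0 < 1 - t := sub_pos.2 ht.2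
  simp only [weight]
  rw [show beta α k + N - 1 = beta α k - 1 + N by ring, show 1 + α + m - 1 = α + m by ring,
    Real.rpow_add_natCast ht.1.ne', Real.rpow_add_natCast h1.ne']
  ring

/-- The new index `m` is the exponent in the geometric expansion of `1 / (1 + y (1 - t))`; the old
indices come from the series of order `k` at `y * t`. -/
lemma coeff_cons {α : ℝ} (hα0 : 0 < α) (k m : ℕ) (n : Fin k → ℕ) :
    coeff α (k + 1) (Fin.cons m n) =
      Real.Gamma (beta α (k + 1)) / (Real.Gamma (beta α k) * Real.Gamma (1 + α)) * coeff α k n *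
        ∫ t in Ioo (0 : ℝ) 1, weight α k t * (t ^ (∑ i, n i) * (1 - t) ^ m) := by
  have h1 : Real.Gamma (beta α k) ≠ 0 := (Real.Gamma_pos_of_pos (beta_pos hα0 k)).ne'
  have h2 : Real.Gamma (beta α (k + 1)) ≠ 0 := (Real.Gamma_pos_of_pos (beta_pos hα0 _)).ne'
  have h3 : Real.Gamma (1 + α) ≠ 0 := (Real.Gamma_pos_of_pos (by linarith)).ne'
  have hb := beta_pos hα0 k
  have h4 : Real.Gamma (beta α k + (∑ i, n i : ℕ)) ≠ 0 :=
    (Real.Gamma_pos_of_pos (by positivity)).ne'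
  rw [integral_weight_mul_pow hα0]
  simp only [coeff, Fin.prod_univ_succ, Fin.sum_univ_succ, Fin.cons_zero, Fin.cons_succ]
  generalize (∏ i, rising (1 + α) (n i)) = p
  simp only [rising]
  field_simp

/-- By `coeff_cons` the new coefficient is the old one times the mean of `t^N (1 - t)^m ≤ 1` under a
normalised Beta weight. This bound supplies absolute convergence of the series for `|y| < 1`. -/
lemma coeff_le_one {α : ℝ} (hα0 : 0 < α) (k : ℕ) (n : Fin k → ℕ) : coeff α k n ≤ 1 := by
  induction k with
  | zero => simp [coeff, rising_zero (beta_pos hα0 0)]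
  | succ k ih =>
    obtain ⟨m, n, rfl⟩ : ∃ m n', n = Fin.cons m n' := ⟨n 0, Fin.tail n, (Fin.cons_self_tail n).symm⟩
    have hG : 0 < Real.Gamma (beta α k) := Real.Gamma_pos_of_pos (beta_pos hα0 k)
    have hG' : 0 < Real.Gamma (beta α (k + 1)) := Real.Gamma_pos_of_pos (beta_pos hα0 _)
    have hG1 : 0 < Real.Gamma (1 + α) := Real.Gamma_pos_of_pos (by linarith)
    have hw := integrableOn_weight hα0 k
    have hle : ∫ t in Ioo (0 : ℝ) 1, weight α k t * (t ^ (∑ i, n i) * (1 - t) ^ m) ≤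
        Real.Gamma (beta α k) * Real.Gamma (1 + α) / Real.Gamma (beta α (k + 1)) := by
      have h0 := integral_weight_mul_pow hα0 k 0 0
      simp only [pow_zero, mul_one, Nat.cast_zero, add_zero] at h0
      rw [← h0]
      refine setIntegral_mono_on ?_ hw measurableSet_Ioo fun t ht => ?_
      · rw [← integrableOn_Icc_iff_integrableOn_Ioo] at hw ⊢
        exact hw.mul_continuousOn (by fun_prop) isCompact_Icc
      · refine mul_le_of_le_one_right (weight_pos α k ht).le (mul_le_one₀ ?_ ?_ ?_)
        · exact pow_le_one₀ ht.1.le ht.2.le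
        · exact pow_nonneg (sub_nonneg.2 ht.2.le) _
        · exact pow_le_one₀ (sub_nonneg.2 ht.2.le) (by linarith [ht.1])
    rw [coeff_cons hα0]
    calc _ ≤ Real.Gamma (beta α (k + 1)) / (Real.Gamma (beta α k) * Real.Gamma (1 + α)) * 1 *
          (Real.Gamma (beta α k) * Real.Gamma (1 + α) / Real.Gamma (beta α (k + 1))) := by
          have hc := (coeff_pos hα0 k n).le
          have hI : 0 ≤ ∫ t in Ioo (0 : ℝ) 1, weight α k t * (t ^ (∑ i, n i) * (1 - t) ^ m) :=
            setIntegral_nonneg measurableSet_Ioo fun t ht => mul_nonneg (weight_pos α k ht).le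
              (mul_nonneg (pow_nonneg ht.1.le _) (pow_nonneg (sub_nonneg.2 ht.2.le) _))
          gcongr
          exact ih n
      _ = 1 := by field_simp

lemma summable_pow_sum {r : ℝ} (h0 : 0 ≤ r) (h1 : r < 1) (k : ℕ) :
    Summable fun n : Fin k → ℕ => r ^ (∑ i, n i) := by
  induction k with
  | zero => exact (hasSum_fintype _).summable
  | succ k ih =>
    rw [← (Fin.consEquiv fun _ => ℕ).summable_iff]
    have := (summable_geometric_of_lt_one h0 h1).mul_of_nonneg ih
      (fun m => pow_nonneg h0 m) (fun n => pow_nonneg h0 _)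
    refine this.congr fun p => ?_
    simp [Fin.sum_univ_succ, Fin.consEquiv, pow_add]

lemma C_zero {α : ℝ} : C α 0 = C0 α := by
  have := Real.Gamma_mul_Gamma_one_sub α
  simp only [C, C0, beta, pow_zero, mul_one, Nat.cast_zero, zero_mul, add_zero]
  rw [mul_comm (Real.Gamma (1 - α)), this, one_div_div, mul_comm Real.pi]

lemma Gamma_neg_mul_Gamma_one_add (α : ℝ) :
    Real.Gamma (-α) * Real.Gamma (1 + α) = Real.pi / -Real.sin (α * Real.pi) := by
  have h := Real.Gamma_mul_Gamma_one_sub (-α)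
  rwa [sub_neg_eq_add, mul_neg, Real.sin_neg, mul_comm Real.pi α] at h

lemma Gamma_neg_ne_zero {α : ℝ} (hα0 : 0 < α) (hα1 : α < 1) : Real.Gamma (-α) ≠ 0 := by
  have hs : 0 < Real.sin (α * Real.pi) :=
    Real.sin_pos_of_pos_of_lt_pi (by positivity) (by nlinarith [Real.pi_pos])
  refine left_ne_zero_of_mul (b := Real.Gamma (1 + α)) ?_
  rw [Gamma_neg_mul_Gamma_one_add]
  exact div_ne_zero Real.pi_ne_zero (neg_ne_zero.2 hs.ne')

lemma C_ne_zero {α : ℝ} (hα0 : 0 < α) (hα1 : α < 1) (k : ℕ) : C α k ≠ 0 := by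
  have h1 : Real.Gamma (beta α k) ≠ 0 := (Real.Gamma_pos_of_pos (beta_pos hα0 k)).ne'
  have h4 : Real.Gamma (1 - α) ≠ 0 := (Real.Gamma_pos_of_pos (by linarith)).ne'
  exact one_div_ne_zero
    (mul_ne_zero (mul_ne_zero h4 (pow_ne_zero _ (Gamma_neg_ne_zero hα0 hα1))) h1)

/-- The reflection formula at `-α` gives `-C0 α = 1 / (Γ(-α) Γ(1 + α))`; the Gamma factors then
match the normalisation in `coeff_cons`. -/
lemma C_succ {α : ℝ} (hα0 : 0 < α) (hα1 : α < 1) (k : ℕ) :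
    C α (k + 1) * (Real.Gamma (beta α (k + 1)) / (Real.Gamma (beta α k) * Real.Gamma (1 + α))) =
      -C0 α * C α k := by
  have h1 : Real.Gamma (beta α k) ≠ 0 := (Real.Gamma_pos_of_pos (beta_pos hα0 k)).ne'
  have h2 : Real.Gamma (beta α (k + 1)) ≠ 0 := (Real.Gamma_pos_of_pos (beta_pos hα0 _)).ne'
  have h3 : Real.Gamma (1 + α) ≠ 0 := (Real.Gamma_pos_of_pos (by linarith)).ne'
  have h4 : Real.Gamma (1 - α) ≠ 0 := (Real.Gamma_pos_of_pos (by linarith)).ne'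
  have h5 := Gamma_neg_mul_Gamma_one_add α
  have h6 := Gamma_neg_ne_zero hα0 hα1
  have h7 : -C0 α = 1 / (Real.Gamma (-α) * Real.Gamma (1 + α)) := by
    rw [h5, C0]; field_simp
  rw [h7, C, C, pow_succ]
  field_simp

lemma norm_weight_mul_pow_le (α : ℝ) (k : ℕ) {t : ℝ} (ht : t ∈ Ioo (0 : ℝ) 1) (N m : ℕ) :
    ‖weight α k t * (t ^ N * (1 - t) ^ m)‖ ≤ weight α k t := by
  have hwt := (weight_pos α k ht).le
  have h0 : 0 ≤ 1 - t := sub_nonneg.2 ht.2.le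
  rw [Real.norm_of_nonneg (mul_nonneg hwt (mul_nonneg (pow_nonneg ht.1.le _) (pow_nonneg h0 _)))]
  exact mul_le_of_le_one_right hwt (mul_le_one₀ (pow_le_one₀ ht.1.le ht.2.le) (pow_nonneg h0 _)
    (pow_le_one₀ h0 (by linarith [ht.1])))

/-- The recursion is integrated term by term after expanding its kernel as a geometric series and
`regPart α k` by induction. The norms of the terms are dominated by a multiple of `y^(m + n_1 + ⋯ +
n_k)`, summable because `y < 1`. -/
lemma hasSum_regPart {α : ℝ} (hα0 : 0 < α) (hα1 : α < 1) (k : ℕ) {y : ℝ} (hy0 : 0 ≤ y)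
    (hy1 : y < 1) :
    HasSum (fun n : Fin k → ℕ => C α k * (coeff α k n * (-y) ^ (∑ i, n i))) (regPart α k y) := by
  induction k generalizing y with
  | zero =>
    simp [coeff, rising_zero (beta_pos hα0 0), C_zero, regPart]
  | succ k ih =>
    set F : ℕ × (Fin k → ℕ) → ℝ → ℝ := fun p t =>
      weight α k t * ((-(y * (1 - t))) ^ p.1 *
        (C α k * (coeff α k p.2 * (-(y * t)) ^ (∑ i, p.2 i)))) with hF
    have hF' : ∀ p t, F p t = (C α k * coeff α k p.2 * (-y) ^ (p.1 + ∑ i, p.2 i)) *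
        (weight α k t * (t ^ (∑ i, p.2 i) * (1 - t) ^ p.1)) := by
      intro p t
      simp only [hF, neg_mul_eq_neg_mul, mul_pow, pow_add]
      ring
    have hw := integrableOn_weight hα0 k
    have hint : ∀ p, IntegrableOn (F p) (Ioo 0 1) := by
      intro p
      rw [← integrableOn_Icc_iff_integrableOn_Ioo] at hw ⊢
      exact hw.mul_continuousOn (by fun_prop) isCompact_Icc
    have hnorm : ∀ p, ∫ t in Ioo (0 : ℝ) 1, ‖F p t‖ ≤
        (|C α k| * ∫ t in Ioo (0 : ℝ) 1, weight α k t) * (y ^ p.1 * y ^ (∑ i, p.2 i)) := by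
      intro p
      rw [mul_assoc, mul_comm (∫ t in Ioo (0 : ℝ) 1, weight α k t), ← mul_assoc,
        ← integral_const_mul]
      refine setIntegral_mono_on (hint p).norm (hw.const_mul _) measurableSet_Ioo fun t ht => ?_
      rw [hF', norm_mul, norm_mul, norm_mul, norm_pow, norm_neg, Real.norm_eq_abs (C α k),
        Real.norm_of_nonneg hy0, ← pow_add]
      have h1 := norm_weight_mul_pow_le α k ht (∑ i, p.2 i) p.1
      have h2 : ‖coeff α k p.2‖ ≤ 1 := by
        rw [Real.norm_of_nonneg (coeff_pos hα0 k p.2).le]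
        exact coeff_le_one hα0 k p.2
      have h3 : 0 ≤ |C α k| * y ^ (p.1 + ∑ i, p.2 i) := by positivity
      calc _ = |C α k| * y ^ (p.1 + ∑ i, p.2 i) * (‖coeff α k p.2‖ *
              ‖weight α k t * (t ^ (∑ i, p.2 i) * (1 - t) ^ p.1)‖) := by ring
        _ ≤ |C α k| * y ^ (p.1 + ∑ i, p.2 i) * (1 * weight α k t) :=
            mul_le_mul_of_nonneg_left (mul_le_mul h2 h1 (norm_nonneg _) zero_le_one) h3
        _ = _ := by ring
    have hsum : Summable fun p => ∫ t in Ioo (0 : ℝ) 1, ‖F p t‖ := by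
      have hprod : Summable fun p : ℕ × (Fin k → ℕ) => y ^ p.1 * y ^ (∑ i, p.2 i) :=
        Summable.mul_of_nonneg (f := fun m : ℕ => y ^ m)
          (g := fun n : Fin k → ℕ => y ^ (∑ i, n i)) (summable_geometric_of_lt_one hy0 hy1)
          (summable_pow_sum hy0 hy1 k) (fun m => pow_nonneg hy0 m) (fun n => pow_nonneg hy0 _)
      exact Summable.of_nonneg_of_le (fun p => integral_nonneg fun t => norm_nonneg _) hnorm
        (hprod.mul_left _)
    have hS := (hasSum_integral_of_summable_integral_norm hint hsum).mul_left (-C0 α)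
    have hval : ∫ t in Ioo (0 : ℝ) 1, (∑' p, F p t) = ∫ t in Ioo (0 : ℝ) 1,
        weight α k t * (regPart α k (y * t) / (1 + y * (1 - t))) := by
      refine setIntegral_congr_fun measurableSet_Ioo fun t ht => ?_
      have ht1 : 0 ≤ y * (1 - t) := mul_nonneg hy0 (sub_nonneg.2 ht.2.le)
      have ht2 : y * (1 - t) < 1 := by nlinarith [ht.1, ht.2]
      have ht3 : 0 ≤ y * t := mul_nonneg hy0 ht.1.le
      have ht4 : y * t < 1 := by nlinarith [ht.1, ht.2]
      have hg := hasSum_geometric_of_abs_lt_one (r := -(y * (1 - t)))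
        (by rwa [abs_neg, abs_of_nonneg ht1])
      have hi := ih ht3 ht4
      -- The product series is indexed by `ℕ × (Fin k → ℕ)`, which `Fin.consEquiv` later identifies
      -- with the multi-indices of order `k + 1`.
      have hprod := hg.mul hi (summable_mul_of_summable_norm hg.summable.norm hi.summable.norm)
      rw [(hprod.mul_left (weight α k t)).tsum_eq, sub_neg_eq_add]
      ring
    rw [hval] at hS
    rw [← (Fin.consEquiv fun _ => ℕ).hasSum_iff]
    refine (congrArg (HasSum · _) (funext fun p => ?_)).mpr hS
    rw [Function.comp_apply, show (Fin.consEquiv fun _ => ℕ) p = Fin.cons p.1 p.2 from rfl,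
      coeff_cons hα0]
    simp only [hF', integral_const_mul,
      Fin.sum_univ_succ, Fin.cons_zero, Fin.cons_succ]
    linear_combination (coeff α k p.2 * (∫ t in Ioo (0 : ℝ) 1, weight α k t *
      (t ^ (∑ i, p.2 i) * (1 - t) ^ p.1)) * (-y) ^ (p.1 + ∑ i, p.2 i)) * C_succ hα0 hα1 k

lemma isSeriesFunction_gConv {α : ℝ} (hα0 : 0 < α) (hα1 : α < 1) (k : ℕ) :
    IsSeriesFunction α k (gConv α k) := by
  refine ⟨fun x hx => gConv_of_le α k hx, fun x hx => ?_, analyticOnNhd_gConv hα0 k⟩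
  have hC := C_ne_zero hα0 hα1 k
  have h := hasSum_regPart hα0 hα1 k (sub_nonneg.2 hx.1.le) (by linarith [hx.2])
  simp only [neg_sub, ← seriesTerm_eq] at h
  have hs : Summable (seriesTerm α k x) := (summable_mul_left_iff hC).1 h.summable
  refine ⟨hs, ?_⟩
  rw [gConv_of_lt k hx.1, ← h.tsum_eq, tsum_mul_left]
  ring

/-- Uniqueness is the identity theorem on the connected set `(k, ∞)`, started from the interval `(k,
k + 1)`, where the series prescribes the values. -/
lemma eq_gConv_iff_isSeriesFunction {α : ℝ} (hα0 : 0 < α) (hα1 : α < 1) (k : ℕ) (f : ℝ → ℝ) :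
    f = gConv α k ↔ IsSeriesFunction α k f := by
  refine ⟨fun h => h ▸ isSeriesFunction_gConv hα0 hα1 k, fun h => ?_⟩
  have hg := isSeriesFunction_gConv hα0 hα1 k
  ext x
  rcases le_or_gt x k with hx | hx
  · rw [h.1 x hx, hg.1 x hx]
  · have hmem : (k : ℝ) + 1 / 2 ∈ Ioo (k : ℝ) (k + 1) := ⟨by linarith, by linarith⟩
    refine h.2.2.eqOn_of_preconnected_of_eventuallyEq hg.2.2 isPreconnected_Ioi
      (show (k : ℝ) + 1 / 2 ∈ Ioi (k : ℝ) from hmem.1) ?_ hx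
    filter_upwards [isOpen_Ioo.mem_nhds hmem] with z hz
    rw [(h.2.1 z hz).2, (hg.2.1 z hz).2]

/-! ### Convolution identities for the stable subordinator -/

/-- `a` as an extended nonnegative function. -/
def aE (α x : ℝ) : ℝ≥0∞ := ENNReal.ofReal (a α x)

/-- `-b` as an extended nonnegative function. -/
def bE (α x : ℝ) : ℝ≥0∞ := ENNReal.ofReal (-b α x)

/-- The restriction of `a` to `(-∞, 1]`. -/
def aTrunc (α : ℝ) : ℝ → ℝ≥0∞ := (Iic 1).indicator (aE α)

/-- The density `α x^(-α-1)` of the jumps of size at least `1`. -/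
def jump (α : ℝ) : ℝ → ℝ≥0∞ := (Ici 1).indicator fun x => ENNReal.ofReal (α * x ^ (-α - 1))

/-- The density of the first passage position above the level `1` of the stable subordinator. -/
def passage (α : ℝ) : ℝ → ℝ≥0∞ :=
  (Ioi 1).indicator fun x => ENNReal.ofReal (C0 α * ((x - 1) ^ (-α) / x))

/-- The part of `passage` that is due to jumps of size less than `1`. -/
def smallPassage (α : ℝ) : ℝ → ℝ≥0∞ :=
  (Ioo 1 2).indicator fun x => ENNReal.ofReal (C0 α * (((x - 1) ^ (-α) - (x - 1) ^ α) / x))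

lemma measurable_a (α : ℝ) : Measurable (a α) :=
  Measurable.indicator (by fun_prop) measurableSet_Ioi

lemma measurable_b (α : ℝ) : Measurable (b α) :=
  Measurable.indicator (by fun_prop) measurableSet_Ioi

@[fun_prop]
lemma measurable_aE (α : ℝ) : Measurable (aE α) := (measurable_a α).ennreal_ofReal

@[fun_prop]
lemma measurable_bE (α : ℝ) : Measurable (bE α) := (measurable_b α).neg.ennreal_ofReal

@[fun_prop]
lemma measurable_aTrunc (α : ℝ) : Measurable (aTrunc α) :=
  (measurable_aE α).indicator measurableSet_Iic

@[fun_prop]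
lemma measurable_jump (α : ℝ) : Measurable (jump α) :=
  Measurable.indicator (by fun_prop) measurableSet_Ici

@[fun_prop]
lemma measurable_smallPassage (α : ℝ) : Measurable (smallPassage α) :=
  Measurable.indicator (by fun_prop) measurableSet_Ioo

lemma aE_of_nonpos (α : ℝ) {x : ℝ} (hx : x ≤ 0) : aE α x = 0 := by
  rw [aE, a_of_nonpos α hx, ENNReal.ofReal_zero]

lemma bE_of_le_one (α : ℝ) {x : ℝ} (hx : x ≤ 1) : bE α x = 0 := by
  rw [bE, b_of_le_one α hx, neg_zero, ENNReal.ofReal_zero]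

/-- The two terms of the product rule combine because `(x - t) + t = x`. -/
lemma hasDerivAt_jump_primitive (α : ℝ) {t x : ℝ} (ht : 0 < t) (htx : t < x) :
    HasDerivAt (fun t => t ^ α * (x - t) ^ (-α) / x) (t ^ (α - 1) * (α * (x - t) ^ (-α - 1))) t := by
  have hxt : 0 < x - t := sub_pos.2 htx
  have hx : x ≠ 0 := (ht.trans htx).ne'
  have h1 : HasDerivAt (fun t : ℝ => t ^ α) (α * t ^ (α - 1)) t :=
    Real.hasDerivAt_rpow_const (.inl ht.ne')
  have h2 : HasDerivAt (fun t : ℝ => (x - t) ^ (-α)) (-1 * (-α) * (x - t) ^ (-α - 1)) t :=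
    ((hasDerivAt_id t).const_sub x).rpow_const (.inl hxt.ne')
  convert! (h1.mul h2).div_const x using 1
  rw [eq_div_iff hx]
  have h3 : t ^ α = t ^ (α - 1) * t := by rw [← Real.rpow_add_one ht.ne']; ring_nf
  have h4 : (x - t) ^ (-α) = (x - t) ^ (-α - 1) * (x - t) := by
    rw [← Real.rpow_add_one hxt.ne']; ring_nf
  rw [h3, h4]
  ring

lemma lintegral_jump_kernel {α : ℝ} (hα0 : 0 < α) (hα1 : α < 1) {T x : ℝ} (hT : 0 ≤ T)
    (hTx : T < x) :
    ∫⁻ t in Ioc 0 T, ENNReal.ofReal (C0 α * t ^ (α - 1)) *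
      ENNReal.ofReal (α * (x - t) ^ (-α - 1)) =
      ENNReal.ofReal (C0 α * (T ^ α * (x - T) ^ (-α) / x)) := by
  have hC := C0_pos hα0 hα1
  have hcont : ContinuousOn (fun t : ℝ => t ^ α * (x - t) ^ (-α) / x) (Icc 0 T) := by
    refine ContinuousOn.div_const (ContinuousOn.mul ?_ ?_) x
    · exact (Real.continuous_rpow_const hα0.le).continuousOn
    · exact ContinuousOn.rpow_const (by fun_prop) fun t ht => .inl (by linarith [ht.2])
  have hint : IntervalIntegrable (fun t : ℝ => t ^ (α - 1) * (α * (x - t) ^ (-α - 1)))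
      volume 0 T := by
    refine (intervalIntegral.intervalIntegrable_rpow' (by linarith)).mul_continuousOn ?_
    rw [uIcc_of_le hT]
    refine continuousOn_const.mul (ContinuousOn.rpow_const (by fun_prop) fun t ht => .inl ?_)
    linarith [ht.2]
  have hftc := intervalIntegral.integral_eq_sub_of_hasDerivAt_of_le hT hcont
    (fun t ht => hasDerivAt_jump_primitive α ht.1 (ht.2.trans hTx)) hint
  rw [Real.zero_rpow hα0.ne', zero_mul, zero_div, sub_zero,
    intervalIntegral.integral_of_le hT] at hftc
  rw [← hftc, ← integral_const_mul, ofReal_integral_eq_lintegral_ofReal]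
  · refine setLIntegral_congr_fun measurableSet_Ioc fun t ht => ?_
    rw [← ENNReal.ofReal_mul (mul_nonneg hC.le (Real.rpow_nonneg ht.1.le _)), mul_assoc]
  · exact (((intervalIntegrable_iff_integrableOn_Ioc_of_le hT).1 hint)).const_mul _
  · refine (ae_restrict_iff' measurableSet_Ioc).2 (.of_forall fun t ht => ?_)
    have h1 : 0 ≤ x - t := by linarith [ht.2]
    have h2 := ht.1.le
    simp only [Pi.zero_apply]
    positivity

/-- A jump of size at least `1` landing at `x` starts from some `t ≤ x - 1`; taking `T = x - 1` in
the primitive makes `(x - T)^(-α)` equal to `1`, which leaves `-b`. -/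
lemma lconvolution_aE_jump {α : ℝ} (hα0 : 0 < α) (hα1 : α < 1) :
    lconvolution (aE α) (jump α) volume = bE α := by
  ext x
  rw [lconvolution_def]
  have h : ∀ t, aE α t * jump α (-t + x) = (Ioc 0 (x - 1)).indicator (fun t =>
      ENNReal.ofReal (C0 α * t ^ (α - 1)) * ENNReal.ofReal (α * (x - t) ^ (-α - 1))) t := by
    intro t
    by_cases ht : t ∈ Ioc 0 (x - 1)
    · rw [indicator_of_mem ht, aE, a_of_pos α ht.1, jump,
        indicator_of_mem (by simp only [mem_Ici]; linarith [ht.2]), neg_add_eq_sub]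
    · rw [indicator_of_notMem ht]
      rcases le_or_gt t 0 with h0 | h0
      · rw [aE_of_nonpos α h0, zero_mul]
      · have : x - 1 < t := lt_of_not_ge fun h1 => ht ⟨h0, h1⟩
        rw [jump, indicator_of_notMem (by simp only [mem_Ici]; linarith), mul_zero]
  simp only [h]
  rw [lintegral_indicator measurableSet_Ioc]
  rcases le_or_gt x 1 with hx | hx
  · rw [bE_of_le_one α hx, Ioc_eq_empty (by linarith)]
    simp
  · rw [lintegral_jump_kernel hα0 hα1 (by linarith) (by linarith), bE, b_of_one_lt α hx]
    simp

/-- The level `1` is passed either by a jump of size at least `1` from a position at most `1`, or by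
a smaller jump. The cutoff is `T = min 1 (x - 1)`: for `x ≥ 2` large jumps account for all of
`passage`, and for `1 < x < 2` they contribute `C0 (x - 1)^α / x`. -/
lemma lconvolution_aTrunc_jump_add {α : ℝ} (hα0 : 0 < α) (hα1 : α < 1) :
    lconvolution (aTrunc α) (jump α) volume + smallPassage α = passage α := by
  have hC := C0_pos hα0 hα1
  ext x
  rw [Pi.add_apply, lconvolution_def]
  have h : ∀ t, aTrunc α t * jump α (-t + x) = (Ioc 0 (min 1 (x - 1))).indicator (fun t =>
      ENNReal.ofReal (C0 α * t ^ (α - 1)) * ENNReal.ofReal (α * (x - t) ^ (-α - 1))) t := by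
    intro t
    by_cases ht : t ∈ Ioc 0 (min 1 (x - 1))
    · have ht1 := le_min_iff.1 ht.2
      rw [indicator_of_mem ht, aTrunc, indicator_of_mem (mem_Iic.2 ht1.1), aE, a_of_pos α ht.1,
        jump, indicator_of_mem (by simp only [mem_Ici]; linarith), neg_add_eq_sub]
    · rw [indicator_of_notMem ht]
      rcases le_or_gt t 0 with h0 | h0
      · simp [aTrunc, indicator_apply, aE_of_nonpos α h0]
      · have : min 1 (x - 1) < t := lt_of_not_ge fun h1 => ht ⟨h0, h1⟩
        rcases min_lt_iff.1 this with h1 | h1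
        · rw [aTrunc, indicator_of_notMem (by simpa using h1), zero_mul]
        · rw [jump, indicator_of_notMem (by simp only [mem_Ici]; linarith), mul_zero]
  simp only [h]
  rw [lintegral_indicator measurableSet_Ioc]
  rcases le_or_gt x 1 with hx | hx
  · rw [Ioc_eq_empty (by simp [hx]), passage, smallPassage,
      indicator_of_notMem (fun h => hx.not_gt h.1), indicator_of_notMem (notMem_Ioi.2 hx)]
    simp
  · rw [lintegral_jump_kernel hα0 hα1 (le_min zero_le_one (by linarith))
      ((min_le_right _ _).trans_lt (by linarith)), passage, indicator_of_mem (mem_Ioi.2 hx)]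
    have hx0 : 0 < x - 1 := by linarith
    rcases lt_or_ge x 2 with h2 | h2
    · rw [smallPassage, indicator_of_mem (mem_Ioo.2 ⟨hx, h2⟩), min_eq_right (by linarith), sub_sub_cancel,
        Real.one_rpow, mul_one, ← ENNReal.ofReal_add]
      · congr 1; ring
      · positivity
      · refine mul_nonneg hC.le (div_nonneg (sub_nonneg.2 ?_) (by linarith))
        exact Real.rpow_le_rpow_of_exponent_ge hx0 (by linarith) (by linarith)
    · rw [smallPassage, indicator_of_notMem (by simp [h2]), min_eq_left (by linarith),
        Real.one_rpow, one_mul, add_zero]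

lemma lintegral_rpow_mul_exp {c r : ℝ} (hc : 0 < c) (hr : 0 < r) :
    ∫⁻ t in Ioi (0 : ℝ), ENNReal.ofReal (t ^ (c - 1) * Real.exp (-(r * t))) =
      ENNReal.ofReal ((1 / r) ^ c * Real.Gamma c) := by
  have h := Real.integral_rpow_mul_exp_neg_mul_Ioi hc hr
  have hpos : 0 < (1 / r) ^ c * Real.Gamma c :=
    mul_pos (Real.rpow_pos_of_pos (by positivity) _) (Real.Gamma_pos_of_pos hc)
  rw [← h, ofReal_integral_eq_lintegral_ofReal]
  · exact not_imp_comm.1 integral_undef (h ▸ hpos.ne')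
  · refine (ae_restrict_iff' measurableSet_Ioi).2 (.of_forall fun t ht => ?_)
    have : 0 ≤ t := le_of_lt ht
    simp only [Pi.zero_apply]
    positivity

/-- `∫_0^∞ v^(-α) / (1 + v) dv = π / sin(α π)`. -/
lemma lintegral_rpow_div_one_add {α : ℝ} (hα0 : 0 < α) (hα1 : α < 1) :
    ∫⁻ v in Ioi (0 : ℝ), ENNReal.ofReal (v ^ (-α) / (1 + v)) = ENNReal.ofReal (C0 α)⁻¹ := by
  -- Writing `1 / (1 + v) = ∫ e^(-(1 + v) t) dt` and exchanging the integrals produces `Γ(1 - α)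
  -- Γ(α)`, which the reflection formula evaluates.
  have h1 : ∀ v ∈ Ioi (0 : ℝ), ENNReal.ofReal (v ^ (-α) / (1 + v)) =
      ∫⁻ t in Ioi (0 : ℝ), ENNReal.ofReal (v ^ (-α)) * ENNReal.ofReal (Real.exp (-((1 + v) * t))) := by
    intro v hv
    have hv0 : 0 < v := hv
    have := lintegral_rpow_mul_exp one_pos (show 0 < 1 + v by linarith)
    simp only [sub_self, Real.rpow_zero, one_mul, Real.rpow_one, Real.Gamma_one, mul_one] at this
    rw [lintegral_const_mul _ (by fun_prop), this, ← ENNReal.ofReal_mul (by positivity)]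
    congr 1; ring
  rw [setLIntegral_congr_fun measurableSet_Ioi h1, lintegral_lintegral_swap (by fun_prop)]
  have h2 : ∀ t ∈ Ioi (0 : ℝ),
      ∫⁻ v in Ioi (0 : ℝ), ENNReal.ofReal (v ^ (-α)) * ENNReal.ofReal (Real.exp (-((1 + v) * t))) =
      ENNReal.ofReal (Real.Gamma (1 - α)) *
        ENNReal.ofReal (t ^ (α - 1) * Real.exp (-(1 * t))) := by
    intro t ht
    have ht0 : 0 < t := ht
    have := lintegral_rpow_mul_exp (show 0 < 1 - α by linarith) ht0
    have h3 : ∀ v ∈ Ioi (0 : ℝ),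
        ENNReal.ofReal (v ^ (-α)) * ENNReal.ofReal (Real.exp (-((1 + v) * t))) =
        ENNReal.ofReal (Real.exp (-(1 * t))) *
          ENNReal.ofReal (v ^ (1 - α - 1) * Real.exp (-(t * v))) := by
      intro v hv
      have hv0 : 0 < v := hv
      rw [← ENNReal.ofReal_mul (by positivity), ← ENNReal.ofReal_mul (by positivity),
        show -((1 + v) * t) = -(1 * t) + -(t * v) by ring, Real.exp_add,
        show 1 - α - 1 = -α by ring]
      congr 1; ring
    rw [setLIntegral_congr_fun measurableSet_Ioi h3, lintegral_const_mul _ (by fun_prop), this,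
      ← ENNReal.ofReal_mul (by positivity), ← ENNReal.ofReal_mul
        (Real.Gamma_pos_of_pos (by linarith)).le, one_div, Real.inv_rpow ht0.le,
      ← Real.rpow_neg ht0.le, neg_sub]
    congr 1; ring
  rw [setLIntegral_congr_fun measurableSet_Ioi h2, lintegral_const_mul _ (by fun_prop),
    lintegral_rpow_mul_exp hα0 one_pos, ← ENNReal.ofReal_mul (Real.Gamma_pos_of_pos (by linarith)).le]
  have := Real.Gamma_mul_Gamma_one_sub α
  rw [C0, inv_div, mul_comm α, ← this]
  simp [mul_comm]

/-- This Möbius change of variable satisfies `(y - 1) / (x - y) = v / x`, so in the convolution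
`passage * a` the powers of `x + v` cancel and only `v^(-α) / (1 + v)` remains. -/
lemma image_passage_substitution {x : ℝ} (hx : 1 < x) :
    (fun v : ℝ => x * (1 + v) / (x + v)) '' Ioi 0 = Ioo 1 x := by
  ext y
  constructor
  · rintro ⟨v, hv, rfl⟩
    have hv0 : 0 < v := hv
    have hxv : 0 < x + v := by linarith
    exact ⟨by rw [lt_div_iff₀ hxv]; nlinarith, by rw [div_lt_iff₀ hxv]; nlinarith⟩
  · rintro ⟨h1, h2⟩
    have h3 : 0 < x - y := sub_pos.2 h2
    refine ⟨x * (y - 1) / (x - y), div_pos (mul_pos (by linarith) (by linarith)) h3, ?_⟩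
    have h4 : x + x * (y - 1) / (x - y) = x * (x - 1) / (x - y) := by field_simp; ring
    have h5 : x - 1 ≠ 0 := by linarith
    have h6 : x ≠ 0 := by linarith
    simp only [h4]
    field_simp
    ring

lemma injOn_passage_substitution {x : ℝ} (hx : 1 < x) :
    InjOn (fun v : ℝ => x * (1 + v) / (x + v)) (Ioi 0) := by
  intro v hv w hw h
  have hv0 : 0 < v := hv
  have hw0 : 0 < w := hw
  have hxv : x + v ≠ 0 := by linarith
  have hxw : x + w ≠ 0 := by linarith
  simp only at h
  rw [div_eq_div_iff hxv hxw] at h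
  have h1 : (x * (x - 1)) * (v - w) = 0 := by linear_combination h
  rcases mul_eq_zero.1 h1 with h2 | h2
  · nlinarith
  · linarith

lemma hasDerivAt_passage_substitution {x v : ℝ} (hx : 1 < x) (hv : 0 < v) :
    HasDerivAt (fun v : ℝ => x * (1 + v) / (x + v)) (x * (x - 1) / (x + v) ^ 2) v := by
  have hxv : x + v ≠ 0 := by linarith
  have h1 : HasDerivAt (fun v : ℝ => x * (1 + v)) x v := by
    simpa using ((hasDerivAt_id v).const_add 1).const_mul x
  have h2 : HasDerivAt (fun v : ℝ => x + v) 1 v := by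
    simpa using (hasDerivAt_id v).const_add x
  convert! h1.div h2 hxv using 1
  ring

lemma passage_substitution_integrand (α : ℝ) {x v : ℝ} (hx : 1 < x) (hv : 0 < v) :
    x * (x - 1) / (x + v) ^ 2 * ((C0 α * ((x * (1 + v) / (x + v) - 1) ^ (-α) /
      (x * (1 + v) / (x + v)))) * (C0 α * (x - x * (1 + v) / (x + v)) ^ (α - 1))) =
      (C0 α * C0 α * x ^ (α - 1)) * (v ^ (-α) / (1 + v)) := by
  have hxv : 0 < x + v := by linarith
  have hx0 : 0 < x := by linarith
  have hx1 : 0 < x - 1 := by linarith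
  have h1 : x * (1 + v) / (x + v) - 1 = v * ((x - 1) / (x + v)) := by field_simp; ring
  have h2 : x - x * (1 + v) / (x + v) = x * ((x - 1) / (x + v)) := by field_simp; ring
  have hq : 0 < (x - 1) / (x + v) := by positivity
  rw [h1, h2, Real.mul_rpow hv.le hq.le, Real.mul_rpow hx0.le hq.le]
  have h3 : ((x - 1) / (x + v)) ^ (-α) * ((x - 1) / (x + v)) ^ (α - 1) = (x + v) / (x - 1) := by
    rw [← Real.rpow_add hq, show -α + (α - 1) = -1 by ring, Real.rpow_neg_one, inv_div]
  have h4 : x * (x - 1) / (x + v) ^ 2 * ((x + v) / (x - 1)) / (x * (1 + v) / (x + v)) =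
      1 / (1 + v) := by
    field_simp
  calc _ = C0 α * C0 α * v ^ (-α) * x ^ (α - 1) * (x * (x - 1) / (x + v) ^ 2 *
        (((x - 1) / (x + v)) ^ (-α) * ((x - 1) / (x + v)) ^ (α - 1)) /
          (x * (1 + v) / (x + v))) := by ring
    _ = _ := by rw [h3, h4]; ring

/-- Markov property at the first passage above `1`: the potential collected before it is `aTrunc`,
and after it the process restarts from the landing point. -/
lemma lconvolution_passage_aE_add {α : ℝ} (hα0 : 0 < α) (hα1 : α < 1) :
    lconvolution (passage α) (aE α) volume + aTrunc α = aE α := by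
  have hC := C0_pos hα0 hα1
  ext x
  rw [Pi.add_apply, lconvolution_def]
  have h : ∀ y, passage α y * aE α (-y + x) = (Ioo 1 x).indicator (fun y =>
      ENNReal.ofReal (C0 α * ((y - 1) ^ (-α) / y)) * ENNReal.ofReal (C0 α * (x - y) ^ (α - 1))) y := by
    intro y
    by_cases hy : y ∈ Ioo 1 x
    · rw [indicator_of_mem hy, passage, indicator_of_mem (mem_Ioi.2 hy.1), aE,
        a_of_pos α (by linarith [hy.2]), neg_add_eq_sub]
    · rw [indicator_of_notMem hy]
      rcases le_or_gt y 1 with h0 | h0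
      · rw [passage, indicator_of_notMem (notMem_Ioi.2 h0), zero_mul]
      · have : x ≤ y := le_of_not_gt fun h1 => hy ⟨h0, h1⟩
        rw [aE_of_nonpos α (by linarith), mul_zero]
  simp only [h]
  rw [lintegral_indicator measurableSet_Ioo]
  rcases le_or_gt x 1 with hx | hx
  · rw [Ioo_eq_empty (by linarith), aTrunc, indicator_of_mem (mem_Iic.2 hx)]
    simp
  · rw [← image_passage_substitution hx,
      lintegral_image_eq_lintegral_abs_deriv_mul measurableSet_Ioi
        (fun v hv => (hasDerivAt_passage_substitution hx hv).hasDerivWithinAt)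
        (injOn_passage_substitution hx), aTrunc, indicator_of_notMem (by simpa using hx), add_zero]
    have hv : ∀ v ∈ Ioi (0 : ℝ), ENNReal.ofReal |x * (x - 1) / (x + v) ^ 2| *
        (ENNReal.ofReal (C0 α * ((x * (1 + v) / (x + v) - 1) ^ (-α) / (x * (1 + v) / (x + v)))) *
          ENNReal.ofReal (C0 α * (x - x * (1 + v) / (x + v)) ^ (α - 1))) =
        ENNReal.ofReal (C0 α * C0 α * x ^ (α - 1)) * ENNReal.ofReal (v ^ (-α) / (1 + v)) := by
      intro v hv
      have hv0 : 0 < v := hv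
      have hd : 0 ≤ x * (x - 1) / (x + v) ^ 2 :=
        div_nonneg (mul_nonneg (by linarith) (by linarith)) (sq_nonneg _)
      have hm : x * (1 + v) / (x + v) ∈ Ioo 1 x :=
        image_passage_substitution hx ▸ mem_image_of_mem _ hv
      have hm1 : 0 ≤ x * (1 + v) / (x + v) - 1 := sub_nonneg.2 hm.1.le
      have hm2 : 0 ≤ x * (1 + v) / (x + v) := zero_le_one.trans hm.1.le
      rw [abs_of_nonneg hd, ← ENNReal.ofReal_mul (by positivity), ← ENNReal.ofReal_mul hd,
        passage_substitution_integrand α hx hv0, ENNReal.ofReal_mul (by positivity)]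
    rw [setLIntegral_congr_fun measurableSet_Ioi hv, lintegral_const_mul _ (by fun_prop),
      lintegral_rpow_div_one_add hα0 hα1, ← ENNReal.ofReal_mul (by positivity), aE,
      a_of_pos α (by linarith)]
    congr 1
    field_simp

/-! ### The renewal series and the renewal equation -/

lemma add_lconvolution {f g h : ℝ → ℝ≥0∞} (hf : Measurable f) (hh : Measurable h) :
    lconvolution (f + g) h volume = lconvolution f h volume + lconvolution g h volume := by
  ext x
  simp only [lconvolution_def, Pi.add_apply, add_mul]
  exact lintegral_add_left (by fun_prop) _

/-- The convolution of `f` with `n` factors `smallPassage`. -/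
def passagePow (α : ℝ) (f : ℝ → ℝ≥0∞) : ℕ → ℝ → ℝ≥0∞
  | 0 => f
  | n + 1 => lconvolution (passagePow α f n) (smallPassage α) volume

@[fun_prop]
lemma measurable_passagePow (α : ℝ) {f : ℝ → ℝ≥0∞} (hf : Measurable f) (n : ℕ) :
    Measurable (passagePow α f n) := by
  induction n with
  | zero => exact hf
  | succ n ih => exact measurable_lconvolution _ ih (measurable_smallPassage α)

lemma passagePow_of_le (α : ℝ) {f : ℝ → ℝ≥0∞} (hf : ∀ x ≤ 0, f x = 0) (n : ℕ) {x : ℝ}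
    (hx : x ≤ n) : passagePow α f n x = 0 := by
  induction n generalizing x with
  | zero => exact hf x (by simpa using hx)
  | succ n ih =>
    rw [passagePow, lconvolution_def]
    refine (lintegral_congr fun t => ?_).trans lintegral_zero
    push_cast at hx
    rcases le_or_gt t n with h | h
    · rw [ih h, zero_mul]
    · rw [smallPassage, indicator_of_notMem (fun h' => ?_), mul_zero]
      linarith [h'.1]

/-- For `n = 0`, substituting `bE = aE * jump` groups the last two terms into `(aTrunc * jump +
smallPassage) * aE = passage * aE`, which `aTrunc` completes to `aE`. Convolving with `smallPassage`
raises `n`. -/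
lemma passagePow_aTrunc_add {α : ℝ} (hα0 : 0 < α) (hα1 : α < 1) (n : ℕ) :
    passagePow α (aTrunc α) n + lconvolution (passagePow α (aTrunc α) n) (bE α) volume +
      passagePow α (aE α) (n + 1) = passagePow α (aE α) n := by
  have mA := measurable_aE α
  have mT := measurable_aTrunc α
  have mJ := measurable_jump α
  have mB := measurable_bE α
  have mS := measurable_smallPassage α
  induction n with
  | zero =>
    simp only [passagePow]
    rw [add_assoc]
    have h : lconvolution (aTrunc α) (bE α) volume + lconvolution (aE α) (smallPassage α) volume =
        lconvolution (passage α) (aE α) volume := by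
      rw [← lconvolution_aTrunc_jump_add hα0 hα1, add_lconvolution (by fun_prop) mA,
        ← lconvolution_aE_jump hα0 hα1, lconvolution_comm (f := aE α) (g := jump α),
        lconvolution_assoc mT mJ mA, lconvolution_comm (f := aE α) (g := smallPassage α)]
    rw [h, add_comm, lconvolution_passage_aE_add hα0 hα1]
  | succ n ih =>
    have mP := measurable_passagePow α mT n
    have h := congrArg (lconvolution · (smallPassage α) volume) ih
    beta_reduce at h
    rw [add_lconvolution (by fun_prop) mS, add_lconvolution mP mS, ← lconvolution_assoc mP mB mS,
      lconvolution_comm (f := bE α), lconvolution_assoc mP mS mB] at h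
    exact h

lemma sum_passagePow_aTrunc_add {α : ℝ} (hα0 : 0 < α) (hα1 : α < 1) (N : ℕ) (x : ℝ) :
    ∑ n ∈ Finset.range N, (passagePow α (aTrunc α) n x +
      lconvolution (passagePow α (aTrunc α) n) (bE α) volume x) + passagePow α (aE α) N x =
      aE α x := by
  induction N with
  | zero => simp [passagePow]
  | succ N ih =>
    rw [← ih, Finset.sum_range_succ, add_assoc]
    congr 1
    exact congrFun (passagePow_aTrunc_add hα0 hα1 N) x

/-- The renewal density, as an extended nonnegative function. -/
def densityE (α x : ℝ) : ℝ≥0∞ := ∑' n, passagePow α (aTrunc α) n x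

/-- The density of the Darling–Mandelbrot law. -/
def density (α x : ℝ) : ℝ := (densityE α x).toReal

lemma aTrunc_of_nonpos (α : ℝ) {x : ℝ} (hx : x ≤ 0) : aTrunc α x = 0 := by
  simp [aTrunc, indicator_apply, aE_of_nonpos α hx]

@[fun_prop]
lemma measurable_densityE (α : ℝ) : Measurable (densityE α) := by
  unfold densityE
  fun_prop

/-- The telescoping is finite: the `n`-fold terms vanish on `(-∞, n]`, so at a fixed `x` neither a
remainder nor a limit occurs. The subtraction-free form also bounds `densityE` by `aE`, hence its
finiteness. -/
lemma densityE_add_lconvolution {α : ℝ} (hα0 : 0 < α) (hα1 : α < 1) (x : ℝ) :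
    densityE α x + lconvolution (densityE α) (bE α) volume x = aE α x := by
  obtain ⟨N, hN⟩ := exists_nat_ge x
  have h1 : lconvolution (densityE α) (bE α) volume x =
      ∑' n, lconvolution (passagePow α (aTrunc α) n) (bE α) volume x := by
    simp only [lconvolution_def, densityE, ← ENNReal.tsum_mul_right]
    exact lintegral_tsum fun n => by fun_prop
  have h2 : ∀ n, N ≤ n → passagePow α (aTrunc α) n x +
      lconvolution (passagePow α (aTrunc α) n) (bE α) volume x = 0 := by
    intro n hn
    have hle : passagePow α (aTrunc α) n x + lconvolution (passagePow α (aTrunc α) n) (bE α) volume x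
        ≤ passagePow α (aE α) n x := by
      rw [← congrFun (passagePow_aTrunc_add hα0 hα1 n) x]
      exact le_self_add
    rw [passagePow_of_le α (fun x hx => aE_of_nonpos α hx) n
      (hN.trans (by exact_mod_cast hn))] at hle
    exact le_antisymm hle bot_le
  rw [h1, densityE, ← ENNReal.tsum_add, tsum_eq_sum (s := Finset.range N)
    (fun n hn => h2 n (by simpa using hn)), ← sum_passagePow_aTrunc_add hα0 hα1 N x,
    passagePow_of_le α (fun x hx => aE_of_nonpos α hx) N hN, add_zero]

lemma densityE_ne_top {α : ℝ} (hα0 : 0 < α) (hα1 : α < 1) (x : ℝ) : densityE α x ≠ ∞ := by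
  refine ne_top_of_le_ne_top (b := aE α x) ENNReal.ofReal_ne_top ?_
  rw [← densityE_add_lconvolution hα0 hα1 x]
  exact le_self_add

lemma b_nonpos {α : ℝ} (hα0 : 0 < α) (hα1 : α < 1) (x : ℝ) : b α x ≤ 0 := by
  rcases le_or_gt x 1 with h | h
  · exact (b_of_le_one α h).le
  · rw [b_of_one_lt α h, neg_mul, neg_nonpos]
    have := C0_pos hα0 hα1
    have h' : 0 < x - 1 := by linarith
    positivity

lemma a_nonneg {α : ℝ} (hα0 : 0 < α) (hα1 : α < 1) (x : ℝ) : 0 ≤ a α x := by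
  rcases le_or_gt x 0 with h | h
  · exact (a_of_nonpos α h).ge
  · rw [a_of_pos α h]
    have := C0_pos hα0 hα1
    positivity

lemma density_nonneg (α x : ℝ) : 0 ≤ density α x := ENNReal.toReal_nonneg

lemma ofReal_density {α : ℝ} (hα0 : 0 < α) (hα1 : α < 1) (x : ℝ) :
    ENNReal.ofReal (density α x) = densityE α x :=
  ENNReal.ofReal_toReal (densityE_ne_top hα0 hα1 x)

/-- The renewal equation `g = a + g * b`. -/
lemma density_eq {α : ℝ} (hα0 : 0 < α) (hα1 : α < 1) (x : ℝ) :
    density α x = a α x + ∫ t, density α t * b α (x - t) := by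
  have h := densityE_add_lconvolution hα0 hα1 x
  have hint : ∫ t, density α t * -b α (x - t) =
      (lconvolution (densityE α) (bE α) volume x).toReal := by
    rw [integral_eq_lintegral_of_nonneg_ae, lconvolution_def]
    · congr 1
      refine lintegral_congr fun t => ?_
      rw [ENNReal.ofReal_mul (density_nonneg α t), ofReal_density hα0 hα1, bE, neg_add_eq_sub]
    · exact .of_forall fun t => mul_nonneg (density_nonneg α t)
        (neg_nonneg.2 (b_nonpos hα0 hα1 _))
    · exact (((measurable_densityE α).ennreal_toReal).mul
        ((measurable_b α).comp (by fun_prop)).neg).aestronglyMeasurable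
  have htop : lconvolution (densityE α) (bE α) volume x ≠ ∞ := by
    refine ne_top_of_le_ne_top (b := aE α x) ENNReal.ofReal_ne_top ?_
    rw [← h]
    exact le_add_self
  have h' := congrArg ENNReal.toReal h
  rw [ENNReal.toReal_add (densityE_ne_top hα0 hα1 x) htop, ← hint, aE,
    ENNReal.toReal_ofReal (a_nonneg hα0 hα1 x)] at h'
  simp only [mul_neg, integral_neg] at h'
  rw [← h', density]
  ring

lemma density_of_nonpos (α : ℝ) {x : ℝ} (hx : x ≤ 0) : density α x = 0 := by
  have : densityE α x = 0 := ENNReal.tsum_eq_zero.2 fun n =>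
    passagePow_of_le α (fun x hx => aTrunc_of_nonpos α hx) n (hx.trans (Nat.cast_nonneg n))
  rw [density, this, ENNReal.toReal_zero]

/-- Since `b` vanishes on `(-∞, 1]`, the convolution at `x ≤ n + 1` sees the density only on `(-∞,
n]`, where the induction hypothesis applies. Convolving with `b` shifts the index and `a` is the
term `k = 0`. -/
lemma density_eq_sum_gConv {α : ℝ} (hα0 : 0 < α) (hα1 : α < 1) (n : ℕ) {x : ℝ} (hx : x ≤ n) :
    density α x = ∑ k ∈ Finset.range n, gConv α k x := by
  induction n generalizing x with
  | zero => simpa using density_of_nonpos α (by simpa using hx)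
  | succ n ih =>
    push_cast at hx
    have h : ∀ t, density α t * b α (x - t) =
        ∑ k ∈ Finset.range n, gConv α k t * b α (x - t) := by
      intro t
      rcases le_or_gt t n with ht | ht
      · rw [ih ht, Finset.sum_mul]
      · simp [b_of_le_one α (show x - t ≤ 1 by linarith)]
    rw [density_eq hα0 hα1, Finset.sum_range_succ', add_comm]
    simp only [h]
    have hint : ∀ k, Integrable fun t => gConv α k t * b α (x - t) :=
      fun k => convolutionExists_gConv_b hα0 k x
    rw [integral_finsetSum _ fun k _ => hint k]
    rfl

lemma hasSum_gConv {α : ℝ} (hα0 : 0 < α) (hα1 : α < 1) (x : ℝ) :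
    HasSum (fun k => gConv α k x) (density α x) := by
  obtain ⟨n, hn⟩ := exists_nat_ge x
  rw [density_eq_sum_gConv hα0 hα1 n hn]
  refine hasSum_sum_of_ne_finset_zero fun k hk => gConv_of_le α k (hn.trans ?_)
  exact_mod_cast (by simpa using hk : n ≤ k)

lemma continuousOn_density {α : ℝ} (hα0 : 0 < α) (hα1 : α < 1) :
    ContinuousOn (density α) (Ioi 0) := by
  intro x hx
  obtain ⟨n, hn⟩ := exists_nat_gt x
  have hsum : ContinuousOn (fun x => ∑ k ∈ Finset.range n, gConv α k x) (Ioi 0) :=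
    continuousOn_finsetSum _ fun k _ => continuousOn_gConv hα0 k
  have := hsum.continuousAt (isOpen_Ioi.mem_nhds hx)
  refine (this.congr ?_).continuousWithinAt
  filter_upwards [isOpen_Iio.mem_nhds hn] with z hz
  exact (density_eq_sum_gConv hα0 hα1 n hz.le).symm

/-! ### Laplace transforms -/

lemma integrableOn_mul_continuous {f : ℝ → ℝ} {l u : ℝ} (hf : IntegrableOn f (Ioo l u)) {g : ℝ → ℂ}
    (hg : Continuous g) : IntegrableOn (fun x => (f x : ℂ) * g x) (Ioo l u) := by
  rw [← integrableOn_Icc_iff_integrableOn_Ioo] at hf ⊢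
  exact IntegrableOn.mul_continuousOn hf.ofReal hg.continuousOn isCompact_Icc

lemma hasDerivAt_laplace {f : ℝ → ℝ} {l u : ℝ} (hf : IntegrableOn f (Ioo l u)) (z : ℂ) :
    HasDerivAt (fun z : ℂ => ∫ x in Ioo l u, (f x : ℂ) * Complex.exp (-z * x))
      (∫ x in Ioo l u, (f x : ℂ) * (-x * Complex.exp (-z * x))) z := by
  have hc : Continuous fun p : ℂ × ℝ => -(p.2 : ℂ) * Complex.exp (-p.1 * p.2) := by fun_prop
  obtain ⟨M, hM⟩ := ((isCompact_closedBall z 1).prod (isCompact_Icc (a := l) (b := u)))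
    |>.exists_bound_of_continuousOn hc.continuousOn
  refine (hasDerivAt_integral_of_dominated_loc_of_deriv_le
    (μ := volume.restrict (Ioo l u)) (s := Metric.closedBall z 1)
    (F := fun z x => (f x : ℂ) * Complex.exp (-z * x))
    (F' := fun z x => (f x : ℂ) * (-x * Complex.exp (-z * x))) (bound := fun x => ‖f x‖ * M)
    (Metric.closedBall_mem_nhds _ one_pos) (.of_forall fun w => ?_)
    (integrableOn_mul_continuous hf (by fun_prop)) (integrableOn_mul_continuous hf (by fun_prop)).1 ?_
    (hf.norm.mul_const M) (.of_forall fun x w _ => ?_)).2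
  · exact (integrableOn_mul_continuous hf (by fun_prop)).1
  · refine (ae_restrict_iff' measurableSet_Ioo).2 (.of_forall fun x hx w hw => ?_)
    rw [norm_mul, Complex.norm_real]
    gcongr
    exact hM (w, x) ⟨hw, Ioo_subset_Icc_self hx⟩
  · have h1 : HasDerivAt (fun w : ℂ => -w * (x : ℂ)) (-(x : ℂ)) w := by
      simpa using ((hasDerivAt_id w).neg.mul_const (x : ℂ))
    have h2 := h1.cexp.const_mul (f x : ℂ)
    rwa [mul_comm (Complex.exp _)] at h2

/-- The incomplete Gamma type integral `∫_0^1 x^(c-1) e^(-zx) dx`. -/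
def expInt (c : ℝ) (z : ℂ) : ℂ :=
  ∫ x in Ioo (0 : ℝ) 1, ((x ^ (c - 1) : ℝ) : ℂ) * Complex.exp (-z * x)

lemma integrableOn_rpow {c : ℝ} (hc : 0 < c) :
    IntegrableOn (fun x : ℝ => x ^ (c - 1)) (Ioo 0 1) :=
  (intervalIntegral.integrableOn_Ioo_rpow_iff one_pos).2 (by linarith)

lemma integral_rpow_Ioo {c : ℝ} (hc : 0 < c) : ∫ x in Ioo (0 : ℝ) 1, x ^ (c - 1) = 1 / c := by
  rw [← integral_Ioc_eq_integral_Ioo, ← intervalIntegral.integral_of_le zero_le_one,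
    integral_rpow (.inl (by linarith))]
  simp [hc.ne']

lemma expInt_zero {c : ℝ} (hc : 0 < c) : expInt c 0 = 1 / c := by
  simp only [expInt, neg_zero, zero_mul, Complex.exp_zero, mul_one]
  rw [integral_complex_ofReal, integral_rpow_Ioo hc]
  push_cast
  rfl

lemma hasDerivAt_expInt {c : ℝ} (hc : 0 < c) (z : ℂ) :
    HasDerivAt (expInt c) (-expInt (c + 1) z) z := by
  have h := hasDerivAt_laplace (integrableOn_rpow hc) z
  convert! h using 1
  rw [expInt, ← integral_neg]
  refine setIntegral_congr_fun measurableSet_Ioo fun x hx => ?_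
  have : x ^ (c + 1 - 1) = x ^ (c - 1) * x := by
    rw [← Real.rpow_add_one hx.1.ne']; ring_nf
  simp only [this]
  push_cast
  ring

/-- Integration by parts. -/
lemma mul_expInt_add_one {c : ℝ} (hc : 0 < c) (z : ℂ) :
    z * expInt (c + 1) z = c * expInt c z - Complex.exp (-z) := by
  have hi1 := integrableOn_mul_continuous (integrableOn_rpow hc) (g := fun x => Complex.exp (-z * x))
    (by fun_prop)
  have hi2 := integrableOn_mul_continuous (integrableOn_rpow (c := c + 1) (by linarith))
    (g := fun x => Complex.exp (-z * x)) (by fun_prop)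
  have hint : IntegrableOn (fun x : ℝ => (c : ℂ) * (((x ^ (c - 1) : ℝ) : ℂ) * Complex.exp (-z * x)) -
      z * (((x ^ (c + 1 - 1) : ℝ) : ℂ) * Complex.exp (-z * x))) (Ioo 0 1) :=
    (hi1.const_mul _).sub (hi2.const_mul _)
  have hftc := intervalIntegral.integral_eq_sub_of_hasDerivAt_of_le zero_le_one
    (f := fun x : ℝ => ((x ^ c : ℝ) : ℂ) * Complex.exp (-z * x))
    (f' := fun x : ℝ => (c : ℂ) * (((x ^ (c - 1) : ℝ) : ℂ) * Complex.exp (-z * x)) -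
      z * (((x ^ (c + 1 - 1) : ℝ) : ℂ) * Complex.exp (-z * x))) ?_ ?_
    ((intervalIntegrable_iff_integrableOn_Ioo_of_le zero_le_one).2 hint)
  · rw [intervalIntegral.integral_of_le zero_le_one, integral_Ioc_eq_integral_Ioo,
      integral_sub (hi1.const_mul _) (hi2.const_mul _), integral_const_mul, integral_const_mul] at hftc
    simp only [Real.one_rpow, Real.zero_rpow hc.ne', Complex.ofReal_one, Complex.ofReal_zero,
      mul_one, one_mul, zero_mul, sub_zero] at hftc
    rw [← hftc, expInt, expInt]
    ring
  · refine Continuous.continuousOn (Continuous.mul ?_ (by fun_prop))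
    exact Complex.continuous_ofReal.comp (Real.continuous_rpow_const hc.le)
  · intro x hx
    have h1 : HasDerivAt (fun x : ℝ => ((x ^ c : ℝ) : ℂ)) ((c * x ^ (c - 1) : ℝ) : ℂ) x :=
      (Real.hasDerivAt_rpow_const (.inl hx.1.ne')).ofReal_comp
    have h2 : HasDerivAt (fun x : ℝ => Complex.exp (-z * x)) (Complex.exp (-z * x) * (-z)) x := by
      have h3 : HasDerivAt (fun x : ℝ => -z * (x : ℂ)) (-z) x := by
        simpa using (hasDerivAt_id x).ofReal_comp.const_mul (-z)
      exact h3.cexp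
    convert! h1.mul h2 using 1
    rw [add_sub_cancel_right]
    push_cast
    ring

lemma hasSum_expInt {c : ℝ} (hc : 0 < c) (z : ℂ) :
    HasSum (fun n : ℕ => (-z) ^ n / n.factorial * (1 / (n + c))) (expInt c z) := by
  set F : ℕ → ℝ → ℂ := fun n x => ((x ^ (c - 1) : ℝ) : ℂ) * ((-z * x) ^ n / n.factorial) with hF
  have hint : ∀ n, IntegrableOn (F n) (Ioo 0 1) := fun n =>
    integrableOn_mul_continuous (integrableOn_rpow hc) (by fun_prop)
  have hnorm : ∀ n, ∫ x in Ioo (0 : ℝ) 1, ‖F n x‖ ≤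
      ‖z‖ ^ n / n.factorial * ∫ x in Ioo (0 : ℝ) 1, x ^ (c - 1) := by
    intro n
    rw [← integral_const_mul]
    refine setIntegral_mono_on (hint n).norm ((integrableOn_rpow hc).const_mul _)
      measurableSet_Ioo fun x hx => ?_
    have h0 := Real.rpow_nonneg hx.1.le (c - 1)
    simp only [hF, norm_mul, norm_div, norm_pow, norm_neg, Complex.norm_real, Complex.norm_natCast,
      Real.norm_of_nonneg h0, Real.norm_of_nonneg hx.1.le]
    have hx0 := hx.1.le
    rw [mul_comm]
    gcongr
    exact mul_le_of_le_one_right (norm_nonneg z) hx.2.le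
  have hsum : Summable fun n => ∫ x in Ioo (0 : ℝ) 1, ‖F n x‖ :=
    Summable.of_nonneg_of_le (fun n => integral_nonneg fun x => norm_nonneg _) hnorm
      ((Real.summable_pow_div_factorial ‖z‖).mul_right _)
  have h := hasSum_integral_of_summable_integral_norm hint hsum
  have hval : ∀ x : ℝ, ∑' n, F n x = ((x ^ (c - 1) : ℝ) : ℂ) * Complex.exp (-z * x) := by
    intro x
    simp only [hF]
    rw [tsum_mul_left, Complex.exp_eq_exp_ℂ, NormedSpace.exp_eq_tsum_div]
  simp only [hval] at h
  convert! h using 2 with n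
  have hterm : ∀ x ∈ Ioo (0 : ℝ) 1, F n x =
      (-z) ^ n / n.factorial * ((x ^ (n + c - 1) : ℝ) : ℂ) := by
    intro x hx
    rw [show (n : ℝ) + c - 1 = c - 1 + n by ring, Real.rpow_add_natCast hx.1.ne']
    simp only [hF, mul_pow]
    push_cast
    ring
  rw [setIntegral_congr_fun measurableSet_Ioo hterm, integral_const_mul, integral_complex_ofReal,
    integral_rpow_Ioo (by positivity)]
  push_cast
  rfl

/-- The reciprocal of the Laplace transform of the Darling–Mandelbrot law. -/
def laplaceExp (α : ℝ) (z : ℂ) : ℂ := Complex.exp (-z) + z * expInt (1 - α) z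

/-- The coefficients match because `(n + 1) / (n + 1 - α) - 1 = α / (n + 1 - α)`; the subtracted `1`
is the exponential series. -/
lemma phi_eq {α : ℝ} (hα1 : α < 1) (s : ℝ) :
    phi α s = (laplaceExp α (-(Complex.I * s)))⁻¹ := by
  set w : ℂ := Complex.I * s with hw
  have hne : ∀ n : ℕ, (n : ℂ) + 1 - α ≠ 0 := by
    intro n h
    have : ((n : ℝ) + 1 - α : ℝ) = 0 := by exact_mod_cast h
    have hn : (0 : ℝ) ≤ n := n.cast_nonneg
    linarith
  have h1 : HasSum (fun n : ℕ => w ^ (n + 1) / ((n + 1).factorial : ℂ)) (Complex.exp w - 1) := by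
    have := NormedSpace.expSeries_div_hasSum_exp (𝔸 := ℂ) w
    rw [← Complex.exp_eq_exp_ℂ, ← hasSum_nat_add_iff' 1] at this
    simpa using this
  have h2 := (hasSum_expInt (c := 1 - α) (by linarith) (-w)).mul_left w
  rw [neg_neg] at h2
  have h3 := h2.sub h1
  have hterm : ∀ n : ℕ, w * (w ^ n / n.factorial * (1 / (n + ((1 - α : ℝ) : ℂ)))) -
      w ^ (n + 1) / ((n + 1).factorial : ℂ) =
      (α : ℂ) / (((n + 1 : ℕ) : ℂ) - α) * (w ^ (n + 1) / ((n + 1).factorial : ℂ)) := by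
    intro n
    have h4 := hne n
    have h5 : (n : ℂ) + 1 ≠ 0 := by exact_mod_cast n.succ_ne_zero
    have h6 : (n.factorial : ℂ) ≠ 0 := by exact_mod_cast n.factorial_ne_zero
    have h7 : (n : ℂ) + (1 - (α : ℂ)) ≠ 0 := by rwa [← add_sub_assoc]
    rw [Nat.factorial_succ]
    push_cast
    field_simp
    ring
  simp only [hterm] at h3
  rw [phi, ← hw, h3.tsum_eq, laplaceExp, neg_neg]
  congr 1
  ring

lemma hasDerivAt_laplaceExp {α : ℝ} (hα1 : α < 1) (z : ℂ) :
    HasDerivAt (laplaceExp α) (α * expInt (1 - α) z) z := by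
  have h1 : HasDerivAt (fun z : ℂ => Complex.exp (-z)) (-Complex.exp (-z)) z := by
    simpa using (hasDerivAt_id z).neg.cexp
  have h2 := (hasDerivAt_id z).mul (hasDerivAt_expInt (c := 1 - α) (by linarith) z)
  convert! h1.add h2 using 1
  have h3 := mul_expInt_add_one (c := 1 - α) (by linarith) z
  simp only [id]
  push_cast at h3
  linear_combination h3

/-- The Laplace transform of `smallPassage`. -/
def passageLaplace (α : ℝ) (z : ℂ) : ℂ :=
  ∫ x in Ioo (1 : ℝ) 2, ((C0 α * (((x - 1) ^ (-α) - (x - 1) ^ α) / x) : ℝ) : ℂ) *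
    Complex.exp (-z * x)

lemma integrableOn_sub_rpow {α : ℝ} (hα0 : 0 < α) (hα1 : α < 1) :
    IntegrableOn (fun x : ℝ => x ^ (-α) - x ^ α) (Ioo 0 1) := by
  have h1 := integrableOn_rpow (c := 1 - α) (by linarith)
  have h2 := integrableOn_rpow (c := 1 + α) (by linarith)
  convert! h1.sub h2 using 2 with x
  simp only [Pi.sub_apply]
  ring_nf

lemma indicator_Ioo_add_one {E : Type*} [Zero E] (f : ℝ → E) (x : ℝ) :
    (Ioo (1 : ℝ) 2).indicator f (x + 1) = (Ioo (0 : ℝ) 1).indicator (fun x => f (x + 1)) x := by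
  simp only [indicator_apply, mem_Ioo]
  congr 1
  simp only [eq_iff_iff]
  constructor <;> rintro ⟨h1, h2⟩ <;> constructor <;> linarith

lemma integrableOn_passage_kernel {α : ℝ} (hα0 : 0 < α) (hα1 : α < 1) :
    IntegrableOn (fun x : ℝ => C0 α * (((x - 1) ^ (-α) - (x - 1) ^ α) / x)) (Ioo 1 2) := by
  have h1 : IntegrableOn (fun x : ℝ => (x - 1) ^ (-α) - (x - 1) ^ α) (Ioo 1 2) := by
    have h := integrableOn_sub_rpow hα0 hα1
    rw [← integrable_indicator_iff measurableSet_Ioo] at h ⊢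
    have h' := h.comp_sub_right 1
    convert! h' using 2 with x
    have := indicator_Ioo_add_one (fun x : ℝ => (x - 1) ^ (-α) - (x - 1) ^ α) (x - 1)
    simpa using this
  rw [← integrableOn_Icc_iff_integrableOn_Ioo] at h1 ⊢
  have h2 : ContinuousOn (fun x : ℝ => C0 α * x⁻¹) (Icc 1 2) :=
    continuousOn_const.mul (continuousOn_id.inv₀ fun x hx => by
      have := hx.1
      simp only [id]; positivity)
  convert! h1.mul_continuousOn h2 isCompact_Icc using 2 with x
  ring

lemma hasDerivAt_passageLaplace {α : ℝ} (hα0 : 0 < α) (hα1 : α < 1) (z : ℂ) :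
    HasDerivAt (passageLaplace α)
      (-C0 α * Complex.exp (-z) * (expInt (1 - α) z - expInt (α + 1) z)) z := by
  convert! hasDerivAt_laplace (integrableOn_passage_kernel hα0 hα1) z using 1
  rw [← integral_indicator measurableSet_Ioo, ← integral_add_right_eq_self _ (1 : ℝ)]
  simp only [indicator_Ioo_add_one]
  rw [integral_indicator measurableSet_Ioo, expInt, expInt, ← integral_sub, ← integral_const_mul]
  · refine setIntegral_congr_fun measurableSet_Ioo fun x hx => ?_
    have h1 : (x : ℂ) + 1 ≠ 0 := by
      have : x + 1 ≠ 0 := by linarith [hx.1]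
      exact_mod_cast this
    simp only [add_sub_cancel_right, show (1 : ℝ) - α - 1 = -α by ring]
    push_cast
    rw [show -z * ((x : ℂ) + 1) = -z + -z * x by ring, Complex.exp_add]
    field_simp
  · exact integrableOn_mul_continuous (integrableOn_rpow (by linarith)) (by fun_prop)
  · exact integrableOn_mul_continuous (integrableOn_rpow (by linarith)) (by fun_prop)

/-- Transform of the decomposition at first passage, proved by showing that the left side has zero
derivative. The constant is left as the value at `0`; `passageLaplace_zero` shows that it is `1`. -/
lemma laplaceExp_mul_expInt_add_passageLaplace {α : ℝ} (hα0 : 0 < α) (hα1 : α < 1) (z : ℂ) :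
    C0 α * (laplaceExp α z * expInt α z) + passageLaplace α z =
      C0 α * (1 / α) + passageLaplace α 0 := by
  have hd : ∀ z : ℂ, HasDerivAt
      (fun z => C0 α * (laplaceExp α z * expInt α z) + passageLaplace α z) 0 z := by
    intro z
    have h := (((hasDerivAt_laplaceExp hα1 z).mul (hasDerivAt_expInt hα0 z)).const_mul
      (C0 α : ℂ)).add (hasDerivAt_passageLaplace hα0 hα1 z)
    convert! h using 1
    have hα' : (α : ℂ) ≠ 0 := by exact_mod_cast hα0.ne'
    suffices h : α * expInt (1 - α) z * expInt α z - laplaceExp α z * expInt (α + 1) z =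
        Complex.exp (-z) * (expInt (1 - α) z - expInt (α + 1) z) by
      linear_combination -(C0 α : ℂ) * h
    -- Integration by parts gives the claim only after multiplication by `z`, so `z = 0` is checked
    -- directly.
    rcases eq_or_ne z 0 with rfl | hz
    · rw [expInt_zero hα0, laplaceExp]
      simp only [neg_zero, Complex.exp_zero, zero_mul, add_zero]
      field_simp
    · have h1 := mul_expInt_add_one hα0 z
      refine mul_left_cancel₀ hz ?_
      rw [laplaceExp]
      linear_combination (-z * expInt (1 - α) z) * h1
  have hc := is_const_of_deriv_eq_zero (fun z => (hd z).differentiableAt) (fun z => (hd z).deriv) z 0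
  rw [hc, expInt_zero hα0, laplaceExp]
  simp

/-! ### Total masses and the characteristic function -/

lemma lintegral_lconvolution {f g : ℝ → ℝ≥0∞} (hf : Measurable f) (hg : Measurable g) :
    ∫⁻ x, lconvolution f g volume x = (∫⁻ x, f x) * ∫⁻ x, g x := by
  simp only [lconvolution_def]
  rw [lintegral_lintegral_swap (by fun_prop), ← lintegral_mul_const _ hf]
  refine lintegral_congr fun t => ?_
  rw [lintegral_const_mul _ (by fun_prop), lintegral_add_left_eq_self]

lemma lintegral_passage {α : ℝ} (hα0 : 0 < α) (hα1 : α < 1) : ∫⁻ x, passage α x = 1 := by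
  have hC := C0_pos hα0 hα1
  rw [← lintegral_add_right_eq_self _ (1 : ℝ)]
  have h : ∀ v : ℝ, passage α (v + 1) = (Ioi (0 : ℝ)).indicator (fun v =>
      ENNReal.ofReal (C0 α) * ENNReal.ofReal (v ^ (-α) / (1 + v))) v := by
    intro v
    by_cases hv : v ∈ Ioi (0 : ℝ)
    · rw [indicator_of_mem hv, passage, indicator_of_mem (by simpa using hv),
        ← ENNReal.ofReal_mul hC.le, add_sub_cancel_right, add_comm v]
    · rw [indicator_of_notMem hv, passage, indicator_of_notMem (by simpa using hv)]
  simp only [h]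
  rw [lintegral_indicator measurableSet_Ioi, lintegral_const_mul _ (by fun_prop),
    lintegral_rpow_div_one_add hα0 hα1, ← ENNReal.ofReal_mul hC.le, mul_inv_cancel₀ hC.ne',
    ENNReal.ofReal_one]

lemma lintegral_jump {α : ℝ} (hα0 : 0 < α) : ∫⁻ x, jump α x = 1 := by
  rw [jump, lintegral_indicator measurableSet_Ici, setLIntegral_congr Ioi_ae_eq_Ici.symm,
    ← ofReal_integral_eq_lintegral_ofReal, integral_const_mul,
    integral_Ioi_rpow_of_lt (by linarith) one_pos]
  · simp [hα0.ne']
  · exact (integrableOn_Ioi_rpow_of_lt (by linarith) one_pos).const_mul _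
  · refine (ae_restrict_iff' measurableSet_Ioi).2 (.of_forall fun x hx => ?_)
    have : (0 : ℝ) ≤ x := zero_le_one.trans (le_of_lt hx)
    simp only [Pi.zero_apply]
    positivity

lemma aTrunc_eq_indicator (α : ℝ) :
    aTrunc α = (Ioc 0 1).indicator fun x => ENNReal.ofReal (C0 α * x ^ (α - 1)) := by
  ext x
  by_cases hx : x ∈ Ioc (0 : ℝ) 1
  · rw [indicator_of_mem hx, aTrunc, indicator_of_mem (mem_Iic.2 hx.2), aE, a_of_pos α hx.1]
  · rw [indicator_of_notMem hx]
    rcases le_or_gt x 0 with h | h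
    · exact aTrunc_of_nonpos α h
    · rw [aTrunc, indicator_of_notMem (notMem_Iic.2 (lt_of_not_ge fun h' => hx ⟨h, h'⟩))]

lemma lintegral_aTrunc {α : ℝ} (hα0 : 0 < α) (hα1 : α < 1) :
    ∫⁻ x, aTrunc α x = ENNReal.ofReal (C0 α * (1 / α)) := by
  have hC := C0_pos hα0 hα1
  rw [aTrunc_eq_indicator, lintegral_indicator measurableSet_Ioc,
    setLIntegral_congr Ioo_ae_eq_Ioc.symm, ← integral_rpow_Ioo hα0, ← integral_const_mul,
    ofReal_integral_eq_lintegral_ofReal ((integrableOn_rpow hα0).const_mul _)]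
  refine (ae_restrict_iff' measurableSet_Ioo).2 (.of_forall fun x hx => ?_)
  have := hx.1
  simp only [Pi.zero_apply]
  positivity

/-- Total masses in `lconvolution_aTrunc_jump_add`, where `passage` and `jump` both have mass `1`.
Thus `smallPassage` has mass below `1`, and the renewal series, being geometric in mass, sums to
`1`. -/
lemma lintegral_aTrunc_add_smallPassage {α : ℝ} (hα0 : 0 < α) (hα1 : α < 1) :
    ENNReal.ofReal (C0 α * (1 / α)) + ∫⁻ x, smallPassage α x = 1 := by
  rw [← lintegral_passage hα0 hα1, ← lconvolution_aTrunc_jump_add hα0 hα1]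
  simp only [Pi.add_apply]
  rw [lintegral_add_right _ (measurable_smallPassage α),
    lintegral_lconvolution (measurable_aTrunc α) (measurable_jump α), lintegral_jump hα0,
    lintegral_aTrunc hα0 hα1, mul_one]

lemma lintegral_smallPassage_lt_one {α : ℝ} (hα0 : 0 < α) (hα1 : α < 1) :
    ∫⁻ x, smallPassage α x < 1 := by
  have h := lintegral_aTrunc_add_smallPassage hα0 hα1
  have hpos : 0 < ENNReal.ofReal (C0 α * (1 / α)) :=
    ENNReal.ofReal_pos.2 (mul_pos (C0_pos hα0 hα1) (by positivity))
  have hle : ∫⁻ x, smallPassage α x ≤ 1 := h ▸ le_add_self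
  calc ∫⁻ x, smallPassage α x <
        (∫⁻ x, smallPassage α x) + ENNReal.ofReal (C0 α * (1 / α)) :=
        ENNReal.lt_add_right (hle.trans_lt ENNReal.one_lt_top).ne hpos.ne'
    _ = 1 := by rw [add_comm, h]

lemma lintegral_passagePow {α : ℝ} {f : ℝ → ℝ≥0∞} (hf : Measurable f) (n : ℕ) :
    ∫⁻ x, passagePow α f n x = (∫⁻ x, f x) * (∫⁻ x, smallPassage α x) ^ n := by
  induction n with
  | zero => simp [passagePow]
  | succ n ih =>
    rw [passagePow, lintegral_lconvolution (measurable_passagePow α hf n)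
      (measurable_smallPassage α), ih, pow_succ, mul_assoc]

lemma lintegral_densityE {α : ℝ} (hα0 : 0 < α) (hα1 : α < 1) : ∫⁻ x, densityE α x = 1 := by
  have hpos : 0 < ENNReal.ofReal (C0 α * (1 / α)) :=
    ENNReal.ofReal_pos.2 (mul_pos (C0_pos hα0 hα1) (by positivity))
  have h := lintegral_aTrunc_add_smallPassage hα0 hα1
  have hlt := lintegral_smallPassage_lt_one hα0 hα1
  simp only [densityE]
  rw [lintegral_tsum fun n => by fun_prop]
  simp only [lintegral_passagePow (measurable_aTrunc α)]
  rw [ENNReal.tsum_mul_left, ENNReal.tsum_geometric, lintegral_aTrunc hα0 hα1,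
    ← ENNReal.eq_sub_of_add_eq (hlt.trans ENNReal.one_lt_top).ne h,
    ENNReal.mul_inv_cancel hpos.ne' ENNReal.ofReal_ne_top]

/-- The Darling–Mandelbrot law. -/
def law (α : ℝ) : Measure ℝ := volume.withDensity (densityE α)

lemma isProbabilityMeasure_law {α : ℝ} (hα0 : 0 < α) (hα1 : α < 1) :
    IsProbabilityMeasure (law α) :=
  ⟨by rw [law, withDensity_apply _ .univ, setLIntegral_univ, lintegral_densityE hα0 hα1]⟩

lemma charFun_withDensity_indicator {f : ℝ → ℝ} {s : Set ℝ} (hs : MeasurableSet s)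
    (hf : Measurable f) (hf0 : ∀ x ∈ s, 0 ≤ f x) (t : ℝ) :
    charFun (volume.withDensity (s.indicator fun x => ENNReal.ofReal (f x))) t =
      ∫ x in s, (f x : ℂ) * Complex.exp (-(-(Complex.I * t)) * x) := by
  rw [charFun_apply_real, integral_withDensity_eq_integral_toReal_smul
    (hf.ennreal_ofReal.indicator hs), ← integral_indicator hs]
  · congr 1 with x
    by_cases hx : x ∈ s
    · rw [indicator_of_mem hx, indicator_of_mem hx, ENNReal.toReal_ofReal (hf0 x hx),
        Complex.real_smul]
      congr 2
      ring
    · simp [indicator_of_notMem hx]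
  · refine .of_forall fun x => ?_
    by_cases hx : x ∈ s <;> simp [hx]

lemma charFun_aTrunc {α : ℝ} (hα0 : 0 < α) (hα1 : α < 1) (t : ℝ) :
    charFun (volume.withDensity (aTrunc α)) t = C0 α * expInt α (-(Complex.I * t)) := by
  have hC := C0_pos hα0 hα1
  rw [aTrunc_eq_indicator, charFun_withDensity_indicator measurableSet_Ioc (by fun_prop)
    (fun x hx => mul_nonneg hC.le (Real.rpow_nonneg hx.1.le _)), integral_Ioc_eq_integral_Ioo,
    expInt, ← integral_const_mul]
  congr 1 with x
  push_cast
  ring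

lemma charFun_smallPassage {α : ℝ} (hα0 : 0 < α) (hα1 : α < 1) (t : ℝ) :
    charFun (volume.withDensity (smallPassage α)) t = passageLaplace α (-(Complex.I * t)) := by
  have hC := C0_pos hα0 hα1
  rw [smallPassage, charFun_withDensity_indicator measurableSet_Ioo (by fun_prop), passageLaplace]
  intro x hx
  refine mul_nonneg hC.le (div_nonneg (sub_nonneg.2 ?_) (by linarith [hx.1]))
  exact Real.rpow_le_rpow_of_exponent_ge (by linarith [hx.1]) (by linarith [hx.2]) (by linarith)

lemma isFiniteMeasure_smallPassage {α : ℝ} (hα0 : 0 < α) (hα1 : α < 1) :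
    IsFiniteMeasure (volume.withDensity (smallPassage α)) :=
  isFiniteMeasure_withDensity
    ((lintegral_smallPassage_lt_one hα0 hα1).trans ENNReal.one_lt_top).ne

lemma isFiniteMeasure_passagePow {α : ℝ} (hα0 : 0 < α) (hα1 : α < 1) (n : ℕ) :
    IsFiniteMeasure (volume.withDensity (passagePow α (aTrunc α) n)) := by
  refine isFiniteMeasure_withDensity ?_
  rw [lintegral_passagePow (measurable_aTrunc α), lintegral_aTrunc hα0 hα1]
  exact ENNReal.mul_ne_top ENNReal.ofReal_ne_top (ENNReal.pow_ne_top
    ((lintegral_smallPassage_lt_one hα0 hα1).trans ENNReal.one_lt_top).ne)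

lemma charFun_passagePow {α : ℝ} (hα0 : 0 < α) (hα1 : α < 1) (n : ℕ) (t : ℝ) :
    charFun (volume.withDensity (passagePow α (aTrunc α) n)) t =
      C0 α * expInt α (-(Complex.I * t)) * passageLaplace α (-(Complex.I * t)) ^ n := by
  have := isFiniteMeasure_smallPassage hα0 hα1
  induction n with
  | zero => simp [passagePow, charFun_aTrunc hα0 hα1]
  | succ n ih =>
    have := isFiniteMeasure_passagePow hα0 hα1 n
    rw [passagePow, ← conv_withDensity_eq_lconvolution (by fun_prop) (by fun_prop), charFun_conv,
      ih, charFun_smallPassage hα0 hα1, pow_succ, mul_assoc]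

lemma passageLaplace_zero {α : ℝ} (hα0 : 0 < α) (hα1 : α < 1) :
    (C0 α * (1 / α) : ℂ) + passageLaplace α 0 = 1 := by
  have h := charFun_smallPassage hα0 hα1 0
  rw [charFun_zero] at h
  simp only [Complex.ofReal_zero, mul_zero, neg_zero] at h
  rw [← h, measureReal_def, withDensity_apply _ .univ, setLIntegral_univ]
  have h1 := congrArg ENNReal.toReal (lintegral_aTrunc_add_smallPassage hα0 hα1)
  rw [ENNReal.toReal_add ENNReal.ofReal_ne_top
    ((lintegral_smallPassage_lt_one hα0 hα1).trans ENNReal.one_lt_top).ne,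
    ENNReal.toReal_ofReal (mul_pos (C0_pos hα0 hα1) (by positivity)).le, ENNReal.toReal_one] at h1
  exact_mod_cast h1

/-- The characteristic functions of the renewal terms form a geometric series of ratio
`passageLaplace α z`, of modulus at most the mass of `smallPassage`, hence below `1`. -/
lemma charFun_law {α : ℝ} (hα0 : 0 < α) (hα1 : α < 1) (t : ℝ) :
    charFun (law α) t = phi α t := by
  have := isProbabilityMeasure_law hα0 hα1
  have := isFiniteMeasure_smallPassage hα0 hα1
  set z : ℂ := -(Complex.I * t) with hz
  have hlt : ‖passageLaplace α z‖ < 1 := by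
    rw [← charFun_smallPassage hα0 hα1]
    refine (norm_charFun_le t).trans_lt ?_
    rw [measureReal_def, withDensity_apply _ .univ, setLIntegral_univ, ← ENNReal.toReal_one]
    exact (ENNReal.toReal_lt_toReal ((lintegral_smallPassage_lt_one hα0 hα1).trans
      ENNReal.one_lt_top).ne ENNReal.one_ne_top).2 (lintegral_smallPassage_lt_one hα0 hα1)
  have hsum : law α = Measure.sum fun n => volume.withDensity (passagePow α (aTrunc α) n) := by
    rw [law, ← withDensity_tsum fun n => by fun_prop]
    congr 1 with x
    rw [densityE, ENNReal.tsum_apply]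
  have hint : Integrable (fun x : ℝ => Complex.exp (t * x * Complex.I)) (law α) := by
    refine (integrable_const (1 : ℝ)).mono' (by fun_prop) (.of_forall fun x => ?_)
    rw [← Complex.ofReal_mul, Complex.norm_exp_ofReal_mul_I]
  have h1 : HasSum (fun n => charFun (volume.withDensity (passagePow α (aTrunc α) n)) t)
      (charFun (law α) t) := by
    simp only [charFun_apply_real]
    rw [hsum] at hint ⊢
    exact hasSum_integral_measure hint
  simp only [charFun_passagePow hα0 hα1, ← hz] at h1
  have h2 := h1.unique ((hasSum_geometric_of_norm_lt_one hlt).mul_left _)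
  have h3 := laplaceExp_mul_expInt_add_passageLaplace hα0 hα1 z
  rw [passageLaplace_zero hα0 hα1] at h3
  have h4 : (1 - passageLaplace α z) ≠ 0 := by
    intro h
    rw [← sub_eq_zero.1 h] at hlt
    simp at hlt
  have h5 : C0 α * expInt α z * laplaceExp α z = 1 - passageLaplace α z := by
    linear_combination h3
  rw [h2, phi_eq hα1, ← hz]
  -- The denominator of `phi` is nonzero because it divides `1 - passageLaplace α z`.
  have h6 : laplaceExp α z ≠ 0 := fun h => h4 (by rw [← h5, h, mul_zero])
  rw [← h5] at h4 ⊢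
  rw [mul_inv, mul_inv_cancel_left₀ (left_ne_zero_of_mul h4)]

/-! ### Existence and uniqueness of the law and of its density -/

lemma isLaw_law {α : ℝ} (hα0 : 0 < α) (hα1 : α < 1) : IsLaw α (law α) :=
  ⟨isProbabilityMeasure_law hα0 hα1, charFun_law hα0 hα1⟩

lemma IsLaw.eq {α : ℝ} {μ ν : Measure ℝ} (hμ : IsLaw α μ) (hν : IsLaw α ν) : μ = ν := by
  have := hμ.1
  have := hν.1
  exact Measure.ext_of_charFun (funext fun s => (hμ.2 s).trans (hν.2 s).symm)

lemma isContDensity_density {α : ℝ} (hα0 : 0 < α) (hα1 : α < 1) :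
    IsContDensity (law α) (density α) := by
  refine ⟨density_nonneg α, fun x hx => density_of_nonpos α hx, continuousOn_density hα0 hα1, ?_⟩
  simp only [ofReal_density hα0 hα1]
  rfl

lemma IsContDensity.eq {μ : Measure ℝ} {f g : ℝ → ℝ}
    (hf : IsContDensity μ f) (hg : IsContDensity μ g) : f = g := by
  -- `IsContDensity` demands no measurability; it follows from continuity on `(0, ∞)` and vanishing
  -- elsewhere.
  have hmeas : ∀ {h : ℝ → ℝ}, IsContDensity μ h → AEMeasurable h := by
    intro h hh
    have : h = (Ioi 0).indicator h := by
      ext x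
      by_cases hx : x ∈ Ioi (0 : ℝ)
      · rw [indicator_of_mem hx]
      · rw [indicator_of_notMem hx, hh.2.1 x (by simpa using hx)]
    rw [this]
    exact (aemeasurable_indicator_iff measurableSet_Ioi).2
      (hh.2.2.1.aemeasurable measurableSet_Ioi)
  have hae : f =ᵐ[volume] g := by
    have h := (withDensity_eq_iff_of_sigmaFinite (hmeas hf).ennreal_ofReal
      (hmeas hg).ennreal_ofReal).1 (hf.2.2.2.symm.trans hg.2.2.2)
    filter_upwards [h] with x hx
    exact (ENNReal.ofReal_eq_ofReal_iff (hf.1 x) (hg.1 x)).1 hx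
  ext x
  rcases le_or_gt x 0 with hx | hx
  · rw [hf.2.1 x hx, hg.2.1 x hx]
  · exact Measure.eqOn_open_of_ae_eq (ae_restrict_of_ae hae) isOpen_Ioi hf.2.2.1 hg.2.2.1 hx

end DarlingMandelbrot
end

theorem theorem2 (α : ℝ) (hα0 : 0 < α) (hα1 : α < 1) :
    (∃! μ : Measure ℝ, DarlingMandelbrot.IsLaw α μ) ∧
    (∀ μ : Measure ℝ, DarlingMandelbrot.IsLaw α μ → ∀ g : ℝ → ℝ,
      DarlingMandelbrot.IsContDensity μ g ↔
        ∀ x : ℝ, HasSum (fun k : ℕ => DarlingMandelbrot.gConv α k x) (g x)) ∧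
    LocallyFinite (fun k : ℕ => Function.support (DarlingMandelbrot.gConv α k)) ∧
    ∀ k : ℕ,
      ConvolutionExists (DarlingMandelbrot.gConv α k) (DarlingMandelbrot.b α)
        (ContinuousLinearMap.mul ℝ ℝ) volume ∧
      ContinuousOn (DarlingMandelbrot.gConv α k) (Ioi 0) ∧
      Function.support (DarlingMandelbrot.gConv α k) = Ioi (k : ℝ) ∧
      AnalyticOnNhd ℝ (DarlingMandelbrot.gConv α k) (Ioi (k : ℝ)) ∧
      ∀ f : ℝ → ℝ,
        f = DarlingMandelbrot.gConv α k ↔ DarlingMandelbrot.IsSeriesFunction α k f := by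
  have hlaw := DarlingMandelbrot.isLaw_law hα0 hα1
  refine ⟨⟨_, hlaw, fun μ hμ => hμ.eq hlaw⟩, fun μ hμ g => ?_,
    DarlingMandelbrot.locallyFinite_support_gConv hα0 hα1, fun k =>
    ⟨DarlingMandelbrot.convolutionExists_gConv_b hα0 k, DarlingMandelbrot.continuousOn_gConv hα0 k,
      DarlingMandelbrot.support_gConv hα0 hα1 k, DarlingMandelbrot.analyticOnNhd_gConv hα0 k,
      DarlingMandelbrot.eq_gConv_iff_isSeriesFunction hα0 hα1 k⟩⟩
  obtain rfl := hμ.eq hlaw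
  have hdens := DarlingMandelbrot.isContDensity_density hα0 hα1
  have hsum := DarlingMandelbrot.hasSum_gConv hα0 hα1
  refine ⟨fun hg => hg.eq hdens ▸ hsum, fun hg => ?_⟩
  rwa [show g = DarlingMandelbrot.density α from funext fun x => (hg x).unique (hsum x)]
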